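/- Let $\mathbb{C}\langle x_1,\dots,x_d\rangle$ be the $*$-algebra of polynomials in $d$ non-commuting self-adjoint variables. A functional on it is a linear, unital, $*$-compatible map to $\mathbb{C}$; a state is a functional $\phi$ with $\phi[P^*P]\ge 0$ for all $P$. For a functional $\phi$ let $M^\phi(\mathbf w)=\sum_{|\vec u|\ge 1}\phi[x_{\vec u}]w_{\vec u}$ be its moment series (in non-commuting indeterminates), $\eta^\phi=1-(1+M^\phi)^{-1}$ its Boolean cumulant series, and $R^\phi$ its free cumulant series, the solution of $M^\phi(\mathbf w)=R^\phi((1+M^\phi(\mathbf w))\mathbf w)$, where $(1+M^\phi(\mathbf w))\mathbf w$ is the tuple with entries $(1+M^\phi(\mathbf w))w_i$. Functionals $\phi\boxplus\psi$, $\phi^{\boxplus t}$, $\phi\uplus\psi$, $\phi^{\uplus t}$ ($t\in\mathbb{R}$) are defined by $R^{\phi\boxplus\psi}=R^\phi+R^\psi$, $R^{\phi^{\boxplus t}}=tR^\phi$, $\eta^{\phi\uplus\psi}=\eta^\phi+\eta^\psi$, $\eta^{\phi^{\uplus t}}=t\eta^\phi$. A functional $\rho$ is a freely infinitely divisible state if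 $\rho^{\boxplus t}$ is a state for every $t\ge 0$. For $\mathbf a\in\mathbb{R}^d$ put $\delta_{\mathbf a}[P]=P(a_1,\dots,a_d)$ and, for $t\neq -1$, $$\mathbb{B}_{\mathbf a,t}[\rho]=\bigl((\rho^{\boxplus(1+t)}\boxplus\delta_{\mathbf a})\uplus\delta_{-\mathbf a}\bigr)^{\uplus 1/(1+t)},\qquad \mathbb{B}=\mathbb{B}_{0,1}.$$ For functionals $\rho,\psi$ define functionals $\Phi[\rho,\psi]$ and $\Phi[\psi]$ by $$\eta^{\Phi[\rho,\psi]}(\mathbf w)=(1+M^\psi(\mathbf w))^{-1}R^\rho\bigl((1+M^\psi(\mathbf w))\mathbf w\bigr),\qquad \eta^{\Phi[\psi]}(\mathbf w)=\sum_{i=1}^d w_i(1+M^\psi(\mathbf w))w_i .$$ In one variable, let $\mu_{b,0}$ ($b\in\mathbb{R}$) be the functional with Jacobi parameters $(0,b,b,\dots)$, $(1,1,1,\dots)$; thus $\mu_{0,0}$ is the standard semicircular distribution and the $\mu_{b,0}$ are the centered free Poisson distributions of variance one. (a) For functionals with $\phi=\Phi[\rho,\psi]$, any two of $\phi,\rho,\psi$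 determine the third uniquely; for $\psi$ to be determined by $\phi$ and $\rho$ it is assumed that $\rho$ is not of the form $\delta_{\mathbf a}$. (b) If $\rho$ is a freely infinitely divisible state and $\psi$ is a state, then $\Phi[\rho,\psi]$ is a state. Moreover, $\Phi[\rho,\psi]$ has the same mean and covariance as $\rho$. (c) For functionals, $\Phi[\rho,\psi]=\psi$ if and only if $\psi=\rho$; and $\Phi[\sigma,\rho]=\sigma$ if and only if $\sigma=\rho$ or $\sigma=\delta_{\mathbf a}$ for some $\mathbf a$ (so $\rho$ is the unique fixed point of $\Phi[\rho,\cdot]$ and, apart from the $\delta_{\mathbf a}$, the only fixed point of $\Phi[\cdot,\rho]$). In particular, the free product of $d$ standard semicircular distributions is the unique fixed point of $\psi\mapsto\Phi[\psi]$. (d) In one variable, let $\rho$ be a freely infinitely divisible state with mean zero and variance one. Then $\{\Phi[\rho,\psi]:\psi\text{ a state}\}$ is the set of all states with the same mean and covariance as $\rho$ if and only if $\rho=\mu_{b,0}$ for some $b\in\mathbb{R}$. All the $\mu_{b,0}$ are freely infinitely divisible states with mean zero and variance one, $\Phi[\mu_{0,0},\psi]=\Phi[\psi]$ and $\Phi[\mu_{b,0},\psi]=\Phi[\psi\uplus\delta_b]$.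 In $d\ge 2$ variables, for a freely infinitely divisible state $\rho$ with mean zero and identity covariance, $\{\Phi[\rho,\psi]:\psi\text{ a state}\}$ is never the set of all states with the same mean and covariance as $\rho$. (e) For a state $\psi$, the map $\Phi[\cdot,\psi]$ from freely infinitely divisible states to states is onto if and only if $\psi=\delta_{\mathbf a}$ for some $\mathbf a\in\mathbb{R}^d$. The map $\mathbb{B}$ is a bijection of the set of functionals, and for every functional $\rho$ and every $\mathbf a$, $\Phi[\rho,\delta_0]=\mathbb{B}^{-1}[\rho]$ and $$\Phi[\rho,\delta_{\mathbf a}]=\mathbb{B}_{\mathbf a,0}\bigl[\mathbb{B}^{-1}[\rho]\bigr]=\lim_{t\to -1}\mathbb{B}_{\mathbf a,t}[\rho],$$ the limit being taken at each polynomial. -/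

import Mathlib

open Finset
open scoped ComplexConjugate

/-! ### Formal power series in non-commuting variables -/

/-- Formal power series with complex coefficients in the non-commuting variables
`z 0, ..., z (d - 1)`; `F u` is the coefficient of the monomial `z_{u(1)} ... z_{u(n)}`. -/
def NCSeries (d : ℕ) : Type := List (Fin d) → ℂ

namespace NCSeries

variable {d : ℕ}

noncomputable instance : AddCommGroup (NCSeries d) :=
  inferInstanceAs (AddCommGroup (List (Fin d) → ℂ))

noncomputable instance : Module ℂ (NCSeries d) :=
  inferInstanceAs (Module ℂ (List (Fin d) → ℂ))

@[ext] theorem ext {F G : NCSeries d} (h : ∀ u, F u = G u) : F = G := funext h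

theorem zero_apply (u : List (Fin d)) : (0 : NCSeries d) u = 0 := rfl
theorem add_apply (F G : NCSeries d) (u) : (F + G) u = F u + G u := rfl
theorem sub_apply (F G : NCSeries d) (u) : (F - G) u = F u - G u := rfl
theorem neg_apply (F : NCSeries d) (u) : (-F) u = -F u := rfl
theorem smul_apply (c : ℂ) (F : NCSeries d) (u) : (c • F) u = c * F u := rfl

noncomputable instance : One (NCSeries d) := ⟨fun u => if u = [] then 1 else 0⟩

/-- The Cauchy product: a word is cut in two in all possible ways. -/
noncomputable instance : Mul (NCSeries d) :=
  ⟨fun F G u => ∑ k ∈ range (u.length + 1), F (u.take k) * G (u.drop k)⟩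

theorem one_apply (u : List (Fin d)) : (1 : NCSeries d) u = if u = [] then 1 else 0 := rfl

theorem mul_apply (F G : NCSeries d) (u : List (Fin d)) :
    (F * G) u = ∑ k ∈ range (u.length + 1), F (u.take k) * G (u.drop k) := rfl

theorem mul_nil (F G : NCSeries d) : (F * G) [] = F [] * G [] := by
  simp [mul_apply]

/-- The left derivative `D_i`. -/
def leftD (i : Fin d) (F : NCSeries d) : NCSeries d := fun u => F (i :: u)

theorem mul_cons (F G : NCSeries d) (i : Fin d) (u : List (Fin d)) :
    (F * G) (i :: u) = (leftD i F * G) u + F [] * G (i :: u) := by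
  simp only [mul_apply, List.length_cons]
  rw [sum_range_succ']
  simp [leftD]

protected theorem mul_add' (F G H : NCSeries d) : F * (G + H) = F * G + F * H := by
  ext u; simp only [mul_apply, add_apply, mul_add, sum_add_distrib]

protected theorem add_mul' (F G H : NCSeries d) : (F + G) * H = F * H + G * H := by
  ext u; simp only [mul_apply, add_apply, add_mul, sum_add_distrib]

protected theorem smul_mul' (c : ℂ) (F G : NCSeries d) : (c • F) * G = c • (F * G) := by
  ext u; simp only [mul_apply, smul_apply, mul_sum, mul_assoc]

protected theorem mul_smul' (c : ℂ) (F G : NCSeries d) : F * (c • G) = c • (F * G) := by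
  ext u; simp only [mul_apply, smul_apply, mul_sum, mul_left_comm]

protected theorem mul_assoc' (F G H : NCSeries d) : F * G * H = F * (G * H) := by
  ext u
  induction u generalizing F G with
  | nil => simp only [mul_nil, mul_assoc]
  | cons i u ih =>
    have e : leftD i (F * G) = leftD i F * G + F [] • leftD i G := by
      ext v; simp only [leftD, mul_cons, add_apply, smul_apply]
    rw [mul_cons, mul_cons, e, NCSeries.add_mul', NCSeries.smul_mul', add_apply, smul_apply, ih,
      mul_cons, mul_nil]
    ring

protected theorem one_mul' (F : NCSeries d) : 1 * F = F := by
  ext u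
  cases u with
  | nil => simp [mul_nil, one_apply]
  | cons i u =>
    have e : leftD i (1 : NCSeries d) = 0 := by ext v; simp [leftD, one_apply, zero_apply]
    rw [mul_cons, e]
    simp [mul_apply, zero_apply, one_apply]

protected theorem mul_one' (F : NCSeries d) : F * 1 = F := by
  ext u
  induction u generalizing F with
  | nil => simp [mul_nil, one_apply]
  | cons i u ih =>
    rw [mul_cons, ih]
    simp [leftD, one_apply]

noncomputable instance : Ring (NCSeries d) :=
  { (inferInstance : AddCommGroup (NCSeries d)) with
    mul := (· * ·)
    one := 1
    mul_assoc := NCSeries.mul_assoc'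
    one_mul := NCSeries.one_mul'
    mul_one := NCSeries.mul_one'
    left_distrib := NCSeries.mul_add'
    right_distrib := NCSeries.add_mul'
    zero_mul := fun F => by ext u; simp [mul_apply, zero_apply]
    mul_zero := fun F => by ext u; simp [mul_apply, zero_apply] }

/-- The variable `z i`. -/
noncomputable def X (i : Fin d) : NCSeries d := fun u => if u = [i] then 1 else 0

theorem sum_apply {ι : Type*} (s : Finset ι) (f : ι → NCSeries d) (u : List (Fin d)) :
    (∑ i ∈ s, f i) u = ∑ i ∈ s, f i u :=
  map_sum (⟨⟨fun F : NCSeries d => F u, rfl⟩, fun _ _ => rfl⟩ : NCSeries d →+ ℂ) f s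

/-- The inverse of a series with constant term `1`, as the geometric series in `1 - F`. -/
noncomputable def inv (F : NCSeries d) : NCSeries d :=
  fun u => ∑ k ∈ range (u.length + 1), ((1 - F) ^ k) u

/-- The composition `F(H_1, ..., H_d)` with series `H_i` without constant term: every variable
`z i` of `F` is replaced by `H i`. -/
noncomputable def comp (F : NCSeries d) (H : Fin d → NCSeries d) : NCSeries d :=
  fun u => ∑ k ∈ range (u.length + 1), ∑ v : Fin k → Fin d,
    F (List.ofFn v) * (List.ofFn fun j => H (v j)).prod u

/-- Two series agree on the monomials of degree less than `n`. -/
def AgreeTo (n : ℕ) (F G : NCSeries d) : Prop := ∀ u : List (Fin d), u.length < n → F u = G u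

theorem eq_of_agreeTo {F G : NCSeries d} (h : ∀ n, AgreeTo n F G) : F = G := by
  ext u; exact h (u.length + 1) u (Nat.lt_succ_self _)

theorem AgreeTo.mul {n : ℕ} {F F' G G' : NCSeries d} (hF : AgreeTo n F F') (hG : AgreeTo n G G') :
    AgreeTo n (F * G) (F' * G') := by
  intro u hu
  simp only [mul_apply]
  refine sum_congr rfl fun k _ => ?_
  rw [hF _ (by simp; omega), hG _ (by simp; omega)]

theorem AgreeTo.mul_X {n : ℕ} {F G : NCSeries d} (h : AgreeTo n F G) (i : Fin d) :
    AgreeTo (n + 1) (F * X i) (G * X i) := by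
  intro u hu
  simp only [mul_apply]
  refine sum_congr rfl fun k hk => ?_
  simp only [mem_range] at hk
  by_cases hku : k = u.length
  · subst hku; simp [X]
  · rw [h _ (by simp; omega)]

theorem AgreeTo.list_prod {n : ℕ} {L L' : List (NCSeries d)}
    (h : List.Forall₂ (AgreeTo n) L L') : AgreeTo n L.prod L'.prod := by
  induction h with
  | nil => intro u _; rfl
  | cons h _ ih => simpa using h.mul ih

theorem list_prod_apply_eq_zero (L : List (NCSeries d)) (hL : ∀ F ∈ L, F [] = 0)
    (u : List (Fin d)) (hu : u.length < L.length) : L.prod u = 0 := by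
  induction L generalizing u with
  | nil => simp at hu
  | cons F L ih =>
    rw [List.prod_cons, mul_apply]
    refine sum_eq_zero fun k _ => ?_
    by_cases hk : k = 0
    · subst hk; simp [hL F (by simp)]
    · by_cases hun : u = []
      · subst hun; simp [hL F (by simp)]
      · rw [ih (fun G hG => hL G (by simp [hG])) (u.drop k), mul_zero]
        have := List.length_pos_of_ne_nil hun
        simp at hu ⊢
        omega

theorem agreeTo_inv (F : NCSeries d) (hF : F [] = 1) (n : ℕ) :
    AgreeTo n (inv F) (∑ k ∈ range n, (1 - F) ^ k) := by
  intro u hu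
  rw [sum_apply]
  refine sum_subset (fun k hk => by simp at hk ⊢; omega) fun k _ hk => ?_
  rw [← List.prod_replicate]
  refine list_prod_apply_eq_zero _ (fun G hG => ?_) _ (by simp at hk ⊢; omega)
  rw [List.eq_of_mem_replicate hG, sub_apply, hF]; simp [one_apply]

theorem agreeTo_geom (F : NCSeries d) (hF : F [] = 1) (n : ℕ) : AgreeTo n (1 - (1 - F) ^ n) 1 := by
  intro u hu
  rw [sub_apply, ← List.prod_replicate, list_prod_apply_eq_zero _ (fun G hG => ?_) _ (by simpa),
    sub_zero]
  rw [List.eq_of_mem_replicate hG, sub_apply, hF]; simp [one_apply]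

theorem mul_inv (F : NCSeries d) (hF : F [] = 1) : F * inv F = 1 := by
  refine eq_of_agreeTo fun n u hu => ?_
  rw [(AgreeTo.mul (fun _ _ => rfl : AgreeTo n F F) (agreeTo_inv F hF n)) u hu,
    ← agreeTo_geom F hF n u hu, ← mul_neg_geom_sum (1 - F) n, sub_sub_cancel]

theorem inv_mul (F : NCSeries d) (hF : F [] = 1) : inv F * F = 1 := by
  refine eq_of_agreeTo fun n u hu => ?_
  rw [(AgreeTo.mul (agreeTo_inv F hF n) (fun _ _ => rfl : AgreeTo n F F)) u hu,
    ← agreeTo_geom F hF n u hu, ← geom_sum_mul_neg (1 - F) n, sub_sub_cancel]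

theorem inv_nil (F : NCSeries d) : inv F [] = 1 := by simp [inv, one_apply]

/-- The sum of the terms of degree less than `n` of the outer series in a composition. -/
noncomputable def compTrunc (n : ℕ) (F : NCSeries d) (H : Fin d → NCSeries d) : NCSeries d :=
  ∑ k ∈ range n, ∑ v : Fin k → Fin d, F (List.ofFn v) • (List.ofFn fun j => H (v j)).prod

theorem agreeTo_comp (F : NCSeries d) (H : Fin d → NCSeries d) (hH : ∀ i, H i [] = 0) (n : ℕ) :
    AgreeTo n (comp F H) (compTrunc n F H) := by
  intro u hu
  simp only [compTrunc, comp, sum_apply, smul_apply]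
  refine sum_subset (fun k hk => by simp at hk ⊢; omega) fun k _ hk => ?_
  refine sum_eq_zero fun v _ => ?_
  rw [list_prod_apply_eq_zero, mul_zero]
  · intro G hG
    obtain ⟨j, rfl⟩ := (List.mem_ofFn' _ _).1 hG
    exact hH _
  · simp at hk ⊢; omega

theorem comp_nil (F : NCSeries d) (H : Fin d → NCSeries d) : comp F H [] = F [] := by
  simp [comp, one_apply]

theorem comp_agreeTo {n : ℕ} (F : NCSeries d) {H H' : Fin d → NCSeries d}
    (h : ∀ i, AgreeTo n (H i) (H' i)) : AgreeTo n (comp F H) (comp F H') := by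
  intro u hu
  refine sum_congr rfl fun k _ => sum_congr rfl fun v _ => ?_
  rw [AgreeTo.list_prod (n := n) _ u hu]
  rw [List.forall₂_iff_get]
  simp [h]

/-- The `d`-tuple of series `(G w_1, ..., G w_d)`. -/
noncomputable def leftDilate (G : NCSeries d) : Fin d → NCSeries d := fun i => G * X i

theorem leftDilate_nil (G : NCSeries d) (i : Fin d) : leftDilate G i [] = 0 := by
  simp [leftDilate, mul_nil, X]

/-! ### Fixed points of contractions for the degree filtration -/

/-- The value of `T F` up to degree `n` depends only on `F` up to degree `n - 1`. -/
def Contracting (T : NCSeries d → NCSeries d) : Prop :=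
  ∀ n F G, AgreeTo n F G → AgreeTo (n + 1) (T F) (T G)

/-- The coefficientwise limit of the iterates `T (T (... (T 0)))`. -/
noncomputable def fix (T : NCSeries d → NCSeries d) : NCSeries d :=
  fun u => (T^[u.length + 1] 0) u

theorem Contracting.iterate {T : NCSeries d → NCSeries d} (hT : Contracting T) (F G : NCSeries d)
    (n : ℕ) : AgreeTo n (T^[n] F) (T^[n] G) := by
  induction n with
  | zero => intro u hu; simp at hu
  | succ n ih => rw [Function.iterate_succ_apply', Function.iterate_succ_apply']; exact hT _ _ _ ih

theorem Contracting.agreeTo_fix {T : NCSeries d → NCSeries d} (hT : Contracting T) (n : ℕ) :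
    AgreeTo n (fix T) (T^[n] 0) := by
  intro u hu
  obtain ⟨m, rfl⟩ := Nat.exists_eq_add_of_lt hu
  rw [show u.length + m + 1 = (u.length + 1) + m by omega, Function.iterate_add_apply T _ m 0]
  exact hT.iterate _ _ (u.length + 1) u (Nat.lt_succ_self _)

theorem Contracting.fix_eq {T : NCSeries d → NCSeries d} (hT : Contracting T) :
    T (fix T) = fix T := by
  refine eq_of_agreeTo fun n u hu => ?_
  rw [hT n _ _ (hT.agreeTo_fix n) u (by omega), hT.agreeTo_fix (n + 1) u (by omega),
    Function.iterate_succ_apply' T]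

theorem Contracting.unique {T : NCSeries d → NCSeries d} (hT : Contracting T) {F G : NCSeries d}
    (hF : T F = F) (hG : T G = G) : F = G := by
  refine eq_of_agreeTo fun n => ?_
  induction n with
  | zero => intro u hu; simp at hu
  | succ n ih => rw [← hF, ← hG]; exact hT _ _ _ ih

/-! ### Cumulant series -/

/-- The Boolean cumulant series `1 - (1 + M)⁻¹`. -/
noncomputable def etaOf (M : NCSeries d) : NCSeries d := 1 - inv (1 + M)

/-- The moment series `(1 - η)⁻¹ - 1` with Boolean cumulant series `η`. -/
noncomputable def momentOfEta (E : NCSeries d) : NCSeries d := inv (1 - E) - 1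

/-- The free cumulant series `R` of a moment series `M`, the solution of
`R((1 + M(w)) w) = M(w)`. -/
noncomputable def freeOf (M : NCSeries d) : NCSeries d :=
  fix fun R => R + (M - comp R (leftDilate (1 + M)))

/-- The moment series `M` with free cumulant series `R`, the solution of
`M(w) = R((1 + M(w)) w)`. -/
noncomputable def momentOfFree (R : NCSeries d) : NCSeries d :=
  fix fun M => comp R (leftDilate (1 + M))

theorem list_prod_leftDilate (G : NCSeries d) (hG : G [] = 1) (l u : List (Fin d))
    (h : u.length = l.length) : (l.map (leftDilate G)).prod u = if u = l then 1 else 0 := by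
  induction l generalizing u with
  | nil => simp at h; simp [h, one_apply]
  | cons i l ih =>
    obtain ⟨j, v, rfl⟩ := List.exists_cons_of_length_pos (l := u) (by simp [h])
    simp only [List.length_cons, Nat.add_right_cancel_iff] at h
    rw [List.map_cons, List.prod_cons, mul_cons, leftDilate_nil, zero_mul, add_zero, mul_apply,
      sum_range_succ', sum_eq_zero]
    · have : (leftD j (leftDilate G i)) [] = if j = i then 1 else 0 := by
        simp [leftD, leftDilate, mul_cons, mul_nil, X, hG]
      simp only [List.take_zero, List.drop_zero, zero_add, this, ih v h]
      by_cases hj : j = i <;> by_cases hv : v = l <;> simp [hj, hv]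
    · intro k hk
      rw [list_prod_apply_eq_zero, mul_zero]
      · intro F hF
        obtain ⟨i, _, rfl⟩ := List.mem_map.1 hF
        exact leftDilate_nil G i
      · simp at hk ⊢; omega

theorem comp_leftDilate_apply (F G : NCSeries d) (hG : G [] = 1) (u : List (Fin d)) :
    comp F (leftDilate G) u = (∑ k ∈ range u.length, ∑ v : Fin k → Fin d,
      F (List.ofFn v) * (List.ofFn fun j => leftDilate G (v j)).prod u) + F u := by
  rw [comp, sum_range_succ]
  congr 1
  have : ∀ v : Fin u.length → Fin d, F (List.ofFn v) *
      (List.ofFn fun j => leftDilate G (v j)).prod u = if v = u.get then F u else 0 := by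
    intro v
    have e : (List.ofFn fun j => leftDilate G (v j)) = (List.ofFn v).map (leftDilate G) := by
      rw [List.map_ofFn]; rfl
    rw [e, list_prod_leftDilate G hG _ _ (by simp)]
    by_cases h : v = u.get
    · subst h; simp
    · rw [if_neg h, if_neg, mul_zero]
      intro h'
      apply h
      apply List.ofFn_injective
      rw [← h', List.ofFn_get]
  simp [this]

theorem contracting_freeOf (M : NCSeries d) (hM : M [] = 0) :
    Contracting fun R : NCSeries d => R + (M - comp R (leftDilate (1 + M))) := by
  intro n F G h u hu
  have h1 : (1 + M) [] = 1 := by simp [add_apply, one_apply, hM]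
  simp only [add_apply, sub_apply, comp_leftDilate_apply _ _ h1]
  have : ∀ k ∈ range u.length, ∀ v : Fin k → Fin d, F (List.ofFn v) = G (List.ofFn v) := by
    intro k hk v
    apply h
    simp at hk ⊢; omega
  rw [sum_congr rfl fun k hk => sum_congr rfl fun v _ => by rw [this k hk v]]
  ring

theorem contracting_momentOfFree (R : NCSeries d) :
    Contracting fun M : NCSeries d => comp R (leftDilate (1 + M)) := by
  intro n F G h
  refine comp_agreeTo R fun i => AgreeTo.mul_X (fun u hu => ?_) i
  rw [add_apply, add_apply, h u hu]

theorem freeOf_spec (M : NCSeries d) (hM : M [] = 0) :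
    comp (freeOf M) (leftDilate (1 + M)) = M := by
  have := (contracting_freeOf M hM).fix_eq
  exact (sub_eq_zero.1 (left_eq_add.1 this.symm)).symm

theorem freeOf_unique (M R : NCSeries d) (hM : M [] = 0)
    (h : comp R (leftDilate (1 + M)) = M) : R = freeOf M :=
  (contracting_freeOf M hM).unique (by simp [h]) (contracting_freeOf M hM).fix_eq

theorem momentOfFree_spec (R : NCSeries d) :
    comp R (leftDilate (1 + momentOfFree R)) = momentOfFree R :=
  (contracting_momentOfFree R).fix_eq

theorem momentOfFree_unique (M R : NCSeries d) (h : comp R (leftDilate (1 + M)) = M) :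
    M = momentOfFree R :=
  (contracting_momentOfFree R).unique h (contracting_momentOfFree R).fix_eq

theorem momentOfFree_nil (R : NCSeries d) (hR : R [] = 0) : momentOfFree R [] = 0 := by
  rw [← momentOfFree_spec, comp_nil, hR]

theorem freeOf_nil (M : NCSeries d) (hM : M [] = 0) : freeOf M [] = 0 := by
  have := congrFun (freeOf_spec M hM) []
  rwa [comp_nil, hM] at this

theorem etaOf_nil (M : NCSeries d) : etaOf M [] = 0 := by
  simp [etaOf, sub_apply, inv_nil, one_apply]

theorem inv_eq_of_mul_eq_one {F G : NCSeries d} (hF : F [] = 1) (h : F * G = 1) : inv F = G := by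
  rw [← mul_one (inv F), ← h, ← mul_assoc, inv_mul F hF, one_mul]

theorem etaOf_momentOfEta (E : NCSeries d) (hE : E [] = 0) : etaOf (momentOfEta E) = E := by
  have h1 : (1 - E) [] = 1 := by simp [sub_apply, one_apply, hE]
  rw [etaOf, momentOfEta, add_sub_cancel, inv_eq_of_mul_eq_one (inv_nil _) (inv_mul _ h1),
    sub_sub_cancel]

theorem momentOfEta_etaOf (M : NCSeries d) (hM : M [] = 0) : momentOfEta (etaOf M) = M := by
  have h1 : (1 + M) [] = 1 := by simp [add_apply, one_apply, hM]
  rw [etaOf, momentOfEta, sub_sub_cancel, inv_eq_of_mul_eq_one (inv_nil _) (inv_mul _ h1),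
    add_sub_cancel_left]

/-! ### Self-adjoint series -/

/-- The adjoint series: coefficients are conjugated and monomials reversed. -/
noncomputable def adj (F : NCSeries d) : NCSeries d := fun u => conj (F u.reverse)

theorem adj_apply (F : NCSeries d) (u) : adj F u = conj (F u.reverse) := rfl

theorem adj_adj (F : NCSeries d) : adj (adj F) = F := by ext u; simp [adj]

theorem adj_one : adj (1 : NCSeries d) = 1 := by
  ext u; by_cases h : u = [] <;> simp [adj, one_apply, h]

theorem adj_X (i : Fin d) : adj (X i) = X i := by
  ext u
  have : u.reverse = [i] ↔ u = [i] := by rw [List.reverse_eq_iff]; rfl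
  by_cases h : u = [i] <;> simp [adj, X, this, h]

theorem adj_add (F G : NCSeries d) : adj (F + G) = adj F + adj G := by
  ext u; simp [adj, add_apply]

theorem adj_sub (F G : NCSeries d) : adj (F - G) = adj F - adj G := by
  ext u; simp [adj, sub_apply]

theorem adj_smul (c : ℂ) (F : NCSeries d) : adj (c • F) = conj c • adj F := by
  ext u; simp [adj, smul_apply]

theorem adj_sum {ι : Type*} (s : Finset ι) (f : ι → NCSeries d) :
    adj (∑ i ∈ s, f i) = ∑ i ∈ s, adj (f i) := by
  ext u; simp [adj, sum_apply]

theorem adj_mul (F G : NCSeries d) : adj (F * G) = adj G * adj F := by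
  ext u
  simp only [adj_apply, mul_apply, map_sum, map_mul, List.length_reverse]
  rw [← sum_range_reflect]
  refine sum_congr rfl fun k hk => ?_
  simp only [mem_range] at hk
  rw [mul_comm, List.reverse_take, List.reverse_drop,
    show u.length + 1 - 1 - k = u.length - k by omega]

theorem adj_list_prod (L : List (NCSeries d)) : adj L.prod = (L.map adj).reverse.prod := by
  induction L with
  | nil => simp [adj_one]
  | cons F L ih => simp [adj_mul, ih]

theorem AgreeTo.adj {n : ℕ} {F G : NCSeries d} (h : AgreeTo n F G) :
    AgreeTo n (adj F) (adj G) := by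
  intro u hu; rw [adj_apply, adj_apply, h _ (by simpa)]

theorem adj_comp (F : NCSeries d) (H : Fin d → NCSeries d) :
    adj (comp F H) = comp (adj F) fun i => adj (H i) := by
  ext u
  simp only [adj_apply, comp, map_sum, map_mul, List.length_reverse]
  refine sum_congr rfl fun k _ => ?_
  refine Fintype.sum_equiv (Fin.revPerm.arrowCongr (Equiv.refl _)) _ _ fun v => ?_
  have e1 : ∀ {α : Type} (w : Fin k → α), (List.ofFn fun j => w (Fin.rev j)) =
      (List.ofFn w).reverse := by
    intro α w
    apply List.ext_getElem <;> simp
    intro j hj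
    congr 1
    ext
    simp
    omega
  have e2 : (Fin.revPerm.arrowCongr (Equiv.refl (Fin d))) v = fun j => v (Fin.rev j) := by
    ext j; simp [Equiv.arrowCongr]
  rw [e2, e1 v, e1 fun j => NCSeries.adj (H (v j)), List.reverse_reverse]
  congr 1
  rw [← adj_apply, adj_list_prod, List.map_ofFn]
  rfl

theorem adj_inv (F : NCSeries d) (hF : F [] = 1) : adj (inv F) = inv (adj F) := by
  refine (inv_eq_of_mul_eq_one (by simp [adj, hF]) ?_).symm
  rw [← adj_mul, inv_mul F hF, adj_one]

theorem comp_leftDilate_mul (F G : NCSeries d) :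
    comp F (leftDilate G) * G = G * comp F fun i => X i * G := by
  have key : ∀ l : List (Fin d), (l.map (leftDilate G)).prod * G =
      G * (l.map fun i => X i * G).prod := by
    intro l
    induction l with
    | nil => simp
    | cons i l ih =>
      rw [List.map_cons, List.prod_cons, mul_assoc, ih, List.map_cons, List.prod_cons, leftDilate]
      simp only [mul_assoc]
  refine eq_of_agreeTo fun n u hu => ?_
  rw [AgreeTo.mul (agreeTo_comp F _ (leftDilate_nil G) n) (fun _ _ => rfl : AgreeTo n G G) u hu,
    AgreeTo.mul (fun _ _ => rfl : AgreeTo n G G)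
      (agreeTo_comp F (fun i => X i * G) (fun i => by simp [mul_nil, X]) n) u hu]
  refine congrFun (?_ : _ = _) u
  simp only [compTrunc, sum_mul, mul_sum]
  refine Finset.sum_congr rfl fun k _ => Finset.sum_congr rfl fun v _ => ?_
  rw [NCSeries.smul_mul', NCSeries.mul_smul']
  congr 1
  have := key (List.ofFn v)
  simpa only [List.map_ofFn, Function.comp_def] using this

theorem adj_leftDilate (G : NCSeries d) (i : Fin d) : adj (leftDilate G i) = X i * adj G := by
  rw [leftDilate, adj_mul, adj_X]

/-- The series `(1 + M(w))⁻¹ R((1 + M(w)) w)`. -/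
noncomputable def condSeries (R M : NCSeries d) : NCSeries d :=
  inv (1 + M) * comp R (leftDilate (1 + M))

theorem condSeries_nil (R M : NCSeries d) (hR : R [] = 0) : condSeries R M [] = 0 := by
  rw [condSeries, mul_nil, comp_nil, hR, mul_zero]

theorem adj_condSeries (R M : NCSeries d) (hM : M [] = 0) (hRa : adj R = R) (hMa : adj M = M) :
    adj (condSeries R M) = condSeries R M := by
  have h1 : (1 + M) [] = 1 := by simp [add_apply, one_apply, hM]
  have ha : adj (1 + M) = 1 + M := by rw [adj_add, adj_one, hMa]
  rw [condSeries, adj_mul, adj_inv _ h1, ha, adj_comp, hRa]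
  simp only [adj_leftDilate, ha]
  calc comp R (fun i => X i * (1 + M)) * inv (1 + M)
      = inv (1 + M) * ((1 + M) * comp R fun i => X i * (1 + M)) * inv (1 + M) := by
        rw [← mul_assoc (inv (1 + M)), inv_mul _ h1, one_mul]
    _ = inv (1 + M) * comp R (leftDilate (1 + M)) := by
        rw [← comp_leftDilate_mul, mul_assoc, mul_assoc, mul_inv _ h1, mul_one]

theorem adj_etaOf (M : NCSeries d) (hM : M [] = 0) (hMa : adj M = M) : adj (etaOf M) = etaOf M := by
  rw [etaOf, adj_sub, adj_inv _ (by simp [add_apply, one_apply, hM]), adj_add, adj_one, hMa]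

theorem adj_momentOfEta (E : NCSeries d) (hE : E [] = 0) (hEa : adj E = E) :
    adj (momentOfEta E) = momentOfEta E := by
  rw [momentOfEta, adj_sub, adj_inv _ (by simp [sub_apply, one_apply, hE]), adj_sub, adj_one, hEa]

theorem comp_leftDilate_of_adj (R M : NCSeries d) (hM : M [] = 0)
    (h : comp R (fun i => X i * (1 + M)) = M) : comp R (leftDilate (1 + M)) = M := by
  have h1 : (1 + M) [] = 1 := by simp [add_apply, one_apply, hM]
  have := comp_leftDilate_mul R (1 + M)
  rw [h, show (1 + M) * M = M * (1 + M) by noncomm_ring] at this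
  have h2 := congrArg (· * inv (1 + M)) this
  simpa only [mul_assoc, mul_inv _ h1, mul_one] using h2

theorem adj_freeOf (M : NCSeries d) (hM : M [] = 0) (hMa : adj M = M) :
    adj (freeOf M) = freeOf M := by
  refine freeOf_unique _ _ hM (comp_leftDilate_of_adj _ _ hM ?_)
  have := congrArg adj (freeOf_spec M hM)
  rw [adj_comp, hMa] at this
  simpa only [adj_leftDilate, adj_add, adj_one, hMa] using this

theorem adj_momentOfFree (R : NCSeries d) (hR : R [] = 0) (hRa : adj R = R) :
    adj (momentOfFree R) = momentOfFree R := by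
  refine momentOfFree_unique _ _ (comp_leftDilate_of_adj _ _ ?_ ?_)
  · rw [adj_apply, List.reverse_nil, momentOfFree_nil R hR, map_zero]
  have := congrArg adj (momentOfFree_spec R)
  rw [adj_comp, hRa] at this
  simpa only [adj_leftDilate, adj_add, adj_one] using this

end NCSeries

/-! ### Non-commutative polynomials and functionals on them -/

/-- The algebra `ℂ⟨x_1, ..., x_d⟩` of polynomials in `d` non-commuting variables. -/
abbrev NCPoly (d : ℕ) : Type := MonoidAlgebra ℂ (FreeMonoid (Fin d))

namespace NCPoly

variable {d : ℕ}

/-- The monomial `x_{u(1)} ... x_{u(n)}`. -/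
noncomputable def mon (u : List (Fin d)) : NCPoly d := MonoidAlgebra.single (FreeMonoid.ofList u) 1

/-- The variable `x i`. -/
noncomputable def x (i : Fin d) : NCPoly d := mon [i]

/-- The involution of `ℂ⟨x_1, ..., x_d⟩`: conjugate-linear, with
`(x_{u(1)} ... x_{u(n)})* = x_{u(n)} ... x_{u(1)}`. -/
noncomputable def adj (p : NCPoly d) : NCPoly d :=
  p.coeff.sum fun u c => MonoidAlgebra.single (FreeMonoid.ofList u.toList.reverse) (conj c)

theorem mon_mul (u v : List (Fin d)) : mon u * mon v = mon (u ++ v) := by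
  simp [mon, MonoidAlgebra.single_mul_single]

theorem mon_nil : mon ([] : List (Fin d)) = 1 := rfl

theorem adj_single (u : FreeMonoid (Fin d)) (c : ℂ) : adj (MonoidAlgebra.single u c) =
    MonoidAlgebra.single (FreeMonoid.ofList u.toList.reverse) (conj c) := by
  simp [adj]

theorem adj_add (p q : NCPoly d) : adj (p + q) = adj p + adj q := by
  unfold adj
  rw [MonoidAlgebra.coeff_add, Finsupp.sum_add_index'] <;> simp

end NCPoly

/-- A functional on `ℂ⟨x_1, ..., x_d⟩`: linear, unital and compatible with the involution. -/
structure Functional (d : ℕ) where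
  toLin : NCPoly d →ₗ[ℂ] ℂ
  map_one : toLin 1 = 1
  map_adj : ∀ p, toLin p.adj = conj (toLin p)

namespace Functional

variable {d : ℕ}

noncomputable instance : CoeFun (Functional d) fun _ => NCPoly d → ℂ := ⟨fun φ => φ.toLin⟩

/-- A state: a positive definite functional. -/
def IsState (φ : Functional d) : Prop :=
  ∀ p : NCPoly d, 0 ≤ (φ (p.adj * p)).re ∧ (φ (p.adj * p)).im = 0

/-- The mean vector `(φ[x_1], ..., φ[x_d])`. -/
noncomputable def mean (φ : Functional d) : Fin d → ℂ := fun i => φ (NCPoly.x i)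

/-- The covariance matrix `φ[x_i x_j] - φ[x_i] φ[x_j]`. -/
noncomputable def cov (φ : Functional d) : Matrix (Fin d) (Fin d) ℂ :=
  Matrix.of fun i j => φ (NCPoly.x i * NCPoly.x j) - φ (NCPoly.x i) * φ (NCPoly.x j)

/-- The moment generating function `M^φ`, without constant term. -/
noncomputable def M (φ : Functional d) : NCSeries d :=
  fun u => if u = [] then 0 else φ (NCPoly.mon u)

theorem M_nil (φ : Functional d) : φ.M [] = 0 := by simp [M]

theorem apply_mon (φ : Functional d) (u : List (Fin d)) : φ (NCPoly.mon u) = (1 + φ.M) u := by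
  by_cases h : u = []
  · subst h; simp [NCSeries.add_apply, NCSeries.one_apply, M_nil, NCPoly.mon_nil, φ.map_one]
  · simp [NCSeries.add_apply, NCSeries.one_apply, M, h]

theorem adj_M (φ : Functional d) : NCSeries.adj φ.M = φ.M := by
  ext u
  have := φ.map_adj (NCPoly.mon u.reverse)
  by_cases h : u = []
  · simp [NCSeries.adj, M, h]
  · simp only [NCSeries.adj, M, List.reverse_eq_nil_iff, h, if_false]
    rw [← this, NCPoly.mon, NCPoly.adj_single]
    simp [NCPoly.mon]

/-- The functional with prescribed moment generating function `F`. -/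
noncomputable def ofM (F : NCSeries d) (h0 : F [] = 0) (ha : F.adj = F) : Functional d where
  toLin := (Finsupp.linearCombination ℂ fun u : FreeMonoid (Fin d) => (1 + F) u.toList).comp
    (MonoidAlgebra.coeffLinearEquiv ℂ).toLinearMap
  map_one := by
    rw [MonoidAlgebra.one_def]
    simp [NCSeries.add_apply, NCSeries.one_apply, h0]
  map_adj p := by
    have h1 : NCSeries.adj (1 + F) = 1 + F := by rw [NCSeries.adj_add, NCSeries.adj_one, ha]
    induction p using MonoidAlgebra.induction_linear with
    | zero => simp [NCPoly.adj]
    | add p q hp hq => rw [NCPoly.adj_add, map_add, hp, hq, map_add, map_add]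
    | single u c =>
      rw [NCPoly.adj_single]
      have := congrFun h1 u.toList.reverse
      rw [NCSeries.adj_apply, List.reverse_reverse] at this
      simp [← this]

theorem M_ofM (F : NCSeries d) (h0 : F [] = 0) (ha : F.adj = F) : (ofM F h0 ha).M = F := by
  ext u
  by_cases h : u = []
  · subst h; rw [M_nil, h0]
  · simp [M, ofM, NCPoly.mon, h, NCSeries.add_apply, NCSeries.one_apply]

theorem ext_M {φ ψ : Functional d} (h : φ.M = ψ.M) : φ = ψ := by
  have : φ.toLin = ψ.toLin := by
    refine LinearMap.ext fun p => ?_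
    induction p using MonoidAlgebra.induction_linear with
    | zero => simp
    | add p q hp hq => rw [map_add, map_add, hp, hq]
    | single u c =>
      have e : (MonoidAlgebra.single u c : NCPoly d) = c • NCPoly.mon u.toList := by
        simp [NCPoly.mon]
      rw [e, map_smul, map_smul, apply_mon, apply_mon, h]
  cases φ; cases ψ; simp at this; simp [this]

/-- The Boolean cumulant generating function `η^φ = 1 - (1 + M^φ)⁻¹`. -/
noncomputable def eta (φ : Functional d) : NCSeries d := φ.M.etaOf

/-- The free cumulant generating function `R^φ`, where `M^φ(w) = R^φ((1 + M^φ(w)) w)`. -/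
noncomputable def R (φ : Functional d) : NCSeries d := φ.M.freeOf

theorem R_spec (φ : Functional d) : φ.R.comp (NCSeries.leftDilate (1 + φ.M)) = φ.M :=
  NCSeries.freeOf_spec _ φ.M_nil

theorem eta_nil (φ : Functional d) : φ.eta [] = 0 := NCSeries.etaOf_nil _
theorem R_nil (φ : Functional d) : φ.R [] = 0 := NCSeries.freeOf_nil _ φ.M_nil
theorem adj_eta (φ : Functional d) : φ.eta.adj = φ.eta := NCSeries.adj_etaOf _ φ.M_nil φ.adj_M
theorem adj_R (φ : Functional d) : φ.R.adj = φ.R := NCSeries.adj_freeOf _ φ.M_nil φ.adj_M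

theorem add_nil {F G : NCSeries d} (hF : F [] = 0) (hG : G [] = 0) : (F + G) [] = 0 := by
  rw [NCSeries.add_apply, hF, hG, add_zero]

theorem smul_nil {F : NCSeries d} (c : ℂ) (hF : F [] = 0) : (c • F) [] = 0 := by
  rw [NCSeries.smul_apply, hF, mul_zero]

theorem adj_add_eq {F G : NCSeries d} (hF : F.adj = F) (hG : G.adj = G) :
    (F + G).adj = F + G := by
  rw [NCSeries.adj_add, hF, hG]

theorem adj_real_smul_eq {F : NCSeries d} (t : ℝ) (hF : F.adj = F) :
    ((t : ℂ) • F).adj = (t : ℂ) • F := by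
  rw [NCSeries.adj_smul, hF, Complex.conj_ofReal]

/-- The functional with prescribed Boolean cumulant generating function. -/
noncomputable def ofEta (E : NCSeries d) (h0 : E [] = 0) (ha : E.adj = E) : Functional d :=
  ofM E.momentOfEta
    (by rw [NCSeries.momentOfEta, NCSeries.sub_apply, NCSeries.inv_nil, NCSeries.one_apply,
      if_pos rfl, sub_self])
    (NCSeries.adj_momentOfEta E h0 ha)

theorem eta_ofEta (E : NCSeries d) (h0 : E [] = 0) (ha : E.adj = E) : (ofEta E h0 ha).eta = E := by
  rw [eta, ofEta, M_ofM, NCSeries.etaOf_momentOfEta E h0]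

theorem ext_eta {φ ψ : Functional d} (h : φ.eta = ψ.eta) : φ = ψ := by
  apply ext_M
  rw [← NCSeries.momentOfEta_etaOf φ.M φ.M_nil, ← NCSeries.momentOfEta_etaOf ψ.M ψ.M_nil]
  exact congrArg _ h

/-- The functional with prescribed free cumulant generating function. -/
noncomputable def ofR (F : NCSeries d) (h0 : F [] = 0) (ha : F.adj = F) : Functional d :=
  ofM F.momentOfFree (NCSeries.momentOfFree_nil F h0) (NCSeries.adj_momentOfFree F h0 ha)

theorem R_ofR (F : NCSeries d) (h0 : F [] = 0) (ha : F.adj = F) : (ofR F h0 ha).R = F := by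
  rw [R, ofR, M_ofM]
  exact (NCSeries.freeOf_unique _ _ (NCSeries.momentOfFree_nil F h0)
    (NCSeries.momentOfFree_spec F)).symm

theorem ext_R {φ ψ : Functional d} (h : φ.R = ψ.R) : φ = ψ := by
  apply ext_M
  rw [NCSeries.momentOfFree_unique _ _ φ.R_spec, NCSeries.momentOfFree_unique _ _ ψ.R_spec, h]

/-! ### Convolutions and transformations -/

/-- Free convolution `φ ⊞ ψ`. -/
noncomputable def freeConv (φ ψ : Functional d) : Functional d :=
  ofR (φ.R + ψ.R) (add_nil φ.R_nil ψ.R_nil) (adj_add_eq φ.adj_R ψ.adj_R)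

/-- Free convolution power `φ^{⊞ t}`. -/
noncomputable def freePow (φ : Functional d) (t : ℝ) : Functional d :=
  ofR ((t : ℂ) • φ.R) (smul_nil _ φ.R_nil) (adj_real_smul_eq t φ.adj_R)

/-- Boolean convolution `φ ⊎ ψ`. -/
noncomputable def boolConv (φ ψ : Functional d) : Functional d :=
  ofEta (φ.eta + ψ.eta) (add_nil φ.eta_nil ψ.eta_nil) (adj_add_eq φ.adj_eta ψ.adj_eta)

/-- Boolean convolution power `φ^{⊎ t}`. -/
noncomputable def boolPow (φ : Functional d) (t : ℝ) : Functional d :=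
  ofEta ((t : ℂ) • φ.eta) (smul_nil _ φ.eta_nil) (adj_real_smul_eq t φ.adj_eta)

/-- A freely infinitely divisible state: all `ρ^{⊞ t}`, `t ≥ 0`, are states. -/
def IsFreelyInfDiv (ρ : Functional d) : Prop := ∀ t : ℝ, 0 ≤ t → (ρ.freePow t).IsState

/-- The moments `a_{u(1)} ... a_{u(n)}`. -/
noncomputable def deltaSeries (a : Fin d → ℝ) : NCSeries d :=
  fun u => if u = [] then 0 else ((u.map a).prod : ℝ)

/-- The functional `δ_a[P] = P(a_1, ..., a_d)`, for `a ∈ ℝ^d`. -/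
noncomputable def delta (a : Fin d → ℝ) : Functional d :=
  ofM (deltaSeries a) (by simp [deltaSeries]) (by
    ext u
    by_cases h : u = []
    · simp [NCSeries.adj, deltaSeries, h]
    · simp only [NCSeries.adj, deltaSeries, List.reverse_eq_nil_iff, h, if_false,
        Complex.conj_ofReal, List.map_reverse, List.prod_reverse])

/-- The functional `Φ[ρ, ψ]`, defined by
`η^{Φ[ρ, ψ]}(w) = (1 + M^ψ(w))⁻¹ R^ρ((1 + M^ψ(w)) w)`. -/
noncomputable def Phi (ρ ψ : Functional d) : Functional d :=
  ofEta (NCSeries.inv (1 + ψ.M) * ρ.R.comp (NCSeries.leftDilate (1 + ψ.M)))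
    (NCSeries.condSeries_nil _ _ ρ.R_nil)
    (NCSeries.adj_condSeries _ _ ψ.M_nil ρ.adj_R ψ.adj_M)

theorem eta_Phi (ρ ψ : Functional d) : (Phi ρ ψ).eta =
    NCSeries.inv (1 + ψ.M) * ρ.R.comp (fun i => (1 + ψ.M) * NCSeries.X i) :=
  eta_ofEta _ _ _

/-- The one-argument map `Φ[ψ]`, defined by `η^{Φ[ψ]}(w) = ∑ i, w_i (1 + M^ψ(w)) w_i`. -/
noncomputable def PhiOne (ψ : Functional d) : Functional d :=
  ofEta (∑ i, NCSeries.X i * (1 + ψ.M) * NCSeries.X i)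
    (by
      rw [NCSeries.sum_apply]
      exact Finset.sum_eq_zero fun i _ => by simp [NCSeries.mul_nil, NCSeries.X])
    (by
      rw [NCSeries.adj_sum]
      refine Finset.sum_congr rfl fun i _ => ?_
      rw [NCSeries.adj_mul, NCSeries.adj_mul, NCSeries.adj_X, NCSeries.adj_add, NCSeries.adj_one,
        ψ.adj_M, mul_assoc])

/-- The transformation `B_{a,t}[ρ] = ((ρ^{⊞ (1 + t)} ⊞ δ_a) ⊎ δ_{-a})^{⊎ 1/(1 + t)}`, `t ≠ -1`. -/
noncomputable def B (a : Fin d → ℝ) (t : ℝ) (ρ : Functional d) : Functional d :=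
  boolPow (boolConv (freeConv (freePow ρ (1 + t)) (delta a)) (delta (-a))) (1 / (1 + t))

/-- The Boolean-to-free Bercovici-Pata bijection `B = B_{0,1}`. -/
noncomputable def BP (ρ : Functional d) : Functional d := B 0 1 ρ

instance : Nonempty (Functional d) := ⟨delta 0⟩

/-- The series which has the free cumulants of `μ` as coefficients of the powers of `z i`, and no
other terms. -/
noncomputable def marginSeries (i : Fin d) (μ : Functional 1) : NCSeries d :=
  fun u => if ∀ j ∈ u, j = i then μ.R (List.replicate u.length 0) else 0

/-- The free product of functionals in one variable: the variables `x_i` have the distributions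
`μ_i` and all their mixed free cumulants vanish. -/
noncomputable def freeProd (μ : Fin d → Functional 1) : Functional d :=
  ofR (∑ i, marginSeries i (μ i))
    (by
      rw [NCSeries.sum_apply]
      exact Finset.sum_eq_zero fun i _ => by simp [marginSeries, R_nil])
    (by
      rw [NCSeries.adj_sum]
      refine Finset.sum_congr rfl fun i _ => ?_
      ext u
      have := congrFun (μ i).adj_R (List.replicate u.length 0)
      simp only [NCSeries.adj, List.reverse_replicate] at this
      by_cases h : ∀ j ∈ u, j = i
      · simp only [NCSeries.adj, marginSeries, List.mem_reverse, List.length_reverse, if_pos h,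
          this]
      · simp only [NCSeries.adj, marginSeries, List.mem_reverse, if_neg h, map_zero])

/-! ### Functionals in one variable given by Jacobi parameters -/

/-- Multiplication by `x` in the basis `(P_n)` of polynomials with
`x P_n = P_{n+1} + β_n P_n + γ_n P_{n-1}`; a polynomial `∑ f_n P_n` is given by `f`. -/
def jacobiOp (β γ : ℕ → ℝ) : Module.End ℝ (ℕ → ℝ) where
  toFun f n := (if n = 0 then 0 else f (n - 1)) + β n * f n + γ (n + 1) * f (n + 1)
  map_add' f g := by ext n; by_cases h : n = 0 <;> simp [h] <;> ring
  map_smul' c f := by ext n; by_cases h : n = 0 <;> simp [h] <;> ring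

/-- The coefficient of `P_0 = 1` in the expansion of `x ^ n` in the polynomials `P_n`. -/
noncomputable def jacobiSeries (β γ : ℕ → ℝ) : NCSeries 1 :=
  fun u => if u = [] then 0 else ((jacobiOp β γ ^ u.length) (Pi.single 0 1) 0 : ℝ)

/-- The functional in one variable with Jacobi parameters `(β_0, β_1, ...)`, `(γ_1, γ_2, ...)`
(`γ_0` plays no role): the value at `x ^ n` is the coefficient of `P_0 = 1` in the expansion of
`x ^ n` in the polynomials `P_n`. It makes the `P_n` orthogonal, see `ofJacobi_orthogonal`. -/
noncomputable def ofJacobi (β γ : ℕ → ℝ) : Functional 1 :=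
  ofM (jacobiSeries β γ) (by simp [jacobiSeries])
    (by
      ext u
      by_cases h : u = []
      · simp [NCSeries.adj, jacobiSeries, h]
      · simp only [NCSeries.adj, jacobiSeries, List.reverse_eq_nil_iff, h, if_false, Complex.conj_ofReal,
          List.length_reverse])

/-- The monic polynomials with `P_{-1} = 0`, `P_0 = 1`,
`x P_n = P_{n+1} + β_n P_n + γ_n P_{n-1}`. -/
noncomputable def jacobiPoly (β γ : ℕ → ℝ) : ℕ → Polynomial ℝ
  | 0 => 1
  | 1 => Polynomial.X - Polynomial.C (β 0)
  | n + 2 => (Polynomial.X - Polynomial.C (β (n + 1))) * jacobiPoly β γ (n + 1)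
      - Polynomial.C (γ (n + 1)) * jacobiPoly β γ n

theorem jacobiOp_single (β γ : ℕ → ℝ) (n : ℕ) : jacobiOp β γ (Pi.single n 1) =
    Pi.single (n + 1) 1 + β n • Pi.single n 1
      + (if n = 0 then 0 else γ n • Pi.single (n - 1) 1) := by
  ext k
  simp only [jacobiOp, LinearMap.coe_mk, AddHom.coe_mk, Pi.add_apply, Pi.smul_apply, smul_eq_mul]
  rcases k with _ | k <;> rcases n with _ | n <;> simp [Pi.single_apply] <;>
    (try split_ifs) <;> grind

theorem aeval_jacobiPoly (β γ : ℕ → ℝ) (n : ℕ) :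
    Polynomial.aeval (jacobiOp β γ) (jacobiPoly β γ n) (Pi.single 0 1) = Pi.single n 1 := by
  induction n using Nat.twoStepInduction with
  | zero => simp [jacobiPoly]
  | one => simp [jacobiPoly, jacobiOp_single]
  | more n ih1 ih2 =>
    simp only [jacobiPoly, map_sub, map_mul, Polynomial.aeval_X, Polynomial.aeval_C,
      LinearMap.sub_apply, Module.End.mul_apply, ih1, ih2, jacobiOp_single,
      Module.algebraMap_end_apply, Nat.succ_ne_zero, if_false, Nat.add_sub_cancel]
    abel

theorem aeval_jacobiPoly_zero (β γ : ℕ → ℝ) (n m : ℕ) (h : n < m) :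
    Polynomial.aeval (jacobiOp β γ) (jacobiPoly β γ n) (Pi.single m 1) 0 = 0 := by
  induction n using Nat.twoStepInduction generalizing m with
  | zero => simp [jacobiPoly, Pi.single_apply]; omega
  | one =>
    have h0 : m ≠ 0 := by omega
    have h1 : m - 1 ≠ 0 := by omega
    simp [jacobiPoly, jacobiOp_single, h0, h0.symm, h1.symm]
  | more n ih1 ih2 =>
    have h0 : m ≠ 0 := by omega
    rw [jacobiPoly, mul_comm (Polynomial.X - _)]
    simp [jacobiOp_single, h0, ih1 m (by omega), ih2 m (by omega), ih2 (m + 1) (by omega),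
      ih2 (m - 1) (by omega)]

theorem ofJacobi_aeval (β γ : ℕ → ℝ) (P : Polynomial ℝ) :
    ofJacobi β γ (Polynomial.aeval (NCPoly.x 0) P) =
      (Polynomial.aeval (jacobiOp β γ) P (Pi.single 0 1) 0 : ℝ) := by
  have hpow : ∀ n : ℕ, (NCPoly.x 0 : NCPoly 1) ^ n = NCPoly.mon (List.replicate n 0) := by
    intro n
    induction n with
    | zero => simp [NCPoly.mon_nil]
    | succ n ih => rw [pow_succ, ih, NCPoly.x, NCPoly.mon_mul, List.replicate_succ']
  induction P using Polynomial.induction_on' with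
  | add p q hp hq => simp [hp, hq]
  | monomial n c =>
    rw [Polynomial.aeval_monomial, Polynomial.aeval_monomial, hpow, ← Algebra.smul_def,
      ← Algebra.smul_def]
    have : (c • NCPoly.mon (List.replicate n 0) : NCPoly 1) =
        (c : ℂ) • NCPoly.mon (List.replicate n 0) := by
      simp [NCPoly.mon]
    rw [this, map_smul, apply_mon, ofJacobi, M_ofM]
    rcases n with _ | n <;> simp [NCSeries.add_apply, NCSeries.one_apply, jacobiSeries]

theorem ofJacobi_orthogonal (β γ : ℕ → ℝ) (m n : ℕ) (h : m ≠ n) :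
    ofJacobi β γ (Polynomial.aeval (NCPoly.x 0) (jacobiPoly β γ m * jacobiPoly β γ n)) = 0 := by
  wlog hmn : m < n generalizing m n
  · rw [mul_comm]; exact this n m h.symm (by omega)
  rw [ofJacobi_aeval, map_mul, Module.End.mul_apply, aeval_jacobiPoly,
    aeval_jacobiPoly_zero _ _ _ _ hmn, Complex.ofReal_zero]

/-- The normalized free Meixner distribution `μ_{b,c}`, with Jacobi parameters
`(0, b, b, ...)`, `(1, 1 + c, 1 + c, ...)`. In particular `μ_{0,0}` is the standard semicircular
distribution and the `μ_{b,0}` are the centered free Poisson distributions. -/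
noncomputable def freeMeixner (b c : ℝ) : Functional 1 :=
  ofJacobi (fun n => if n = 0 then 0 else b) (fun n => if n = 1 then 1 else 1 + c)

end Functional

namespace NCSeries

variable {d : ℕ}

/-! ### Recursions for products and compositions -/

/-- The right derivative of a series. -/
def rightD (i : Fin d) (F : NCSeries d) : NCSeries d := fun u => F (u ++ [i])

theorem leftD_apply (i : Fin d) (F : NCSeries d) (u : List (Fin d)) : leftD i F u = F (i :: u) :=
  rfl

theorem rightD_apply (i : Fin d) (F : NCSeries d) (u : List (Fin d)) :
    rightD i F u = F (u ++ [i]) := rfl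

theorem adj_leftD (i : Fin d) (F : NCSeries d) : adj (leftD i F) = rightD i (adj F) := by
  ext u; simp [adj_apply, leftD, rightD]

theorem mul_concat (F G : NCSeries d) (i : Fin d) (u : List (Fin d)) :
    (F * G) (u ++ [i]) = (F * rightD i G) u + F (u ++ [i]) * G [] := by
  simp only [mul_apply, List.length_append, List.length_singleton]
  rw [sum_range_succ]
  congr 1
  · refine sum_congr rfl fun k hk => ?_
    simp only [mem_range] at hk
    rw [List.take_append_of_le_length (by omega), List.drop_append_of_le_length (by omega),
      rightD_apply]
  · rw [List.take_of_length_le (by simp), List.drop_of_length_le (by simp)]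

theorem leftD_mul (i : Fin d) (F G : NCSeries d) :
    leftD i (F * G) = leftD i F * G + F [] • leftD i G := by
  ext u; simp [leftD_apply, mul_cons, add_apply, smul_apply]

theorem leftD_one (i : Fin d) : leftD i (1 : NCSeries d) = 0 := by
  ext u; simp [leftD_apply, one_apply, zero_apply]

theorem leftD_X (i j : Fin d) : leftD j (X i : NCSeries d) = if j = i then 1 else 0 := by
  ext u
  by_cases h : j = i <;> simp [leftD_apply, X, one_apply, zero_apply, h]

theorem X_nil (i : Fin d) : (X i : NCSeries d) [] = 0 := by simp [X]

theorem rightD_X (i j : Fin d) : rightD j (X i : NCSeries d) = if j = i then 1 else 0 := by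
  rw [← adj_X i, ← adj_leftD, leftD_X]
  split_ifs
  · exact adj_one
  · ext u; simp [adj_apply, zero_apply]

theorem X_mul_cons (i j : Fin d) (F : NCSeries d) (u : List (Fin d)) :
    (X i * F) (j :: u) = if j = i then F u else 0 := by
  rw [mul_cons, leftD_X, X_nil]
  split_ifs <;> simp [zero_apply]

theorem mul_X_concat (i j : Fin d) (F : NCSeries d) (u : List (Fin d)) :
    (F * X i) (u ++ [j]) = if j = i then F u else 0 := by
  rw [mul_concat, rightD_X, X_nil]
  split_ifs <;> simp [zero_apply]

theorem comp_add (F F' : NCSeries d) (H : Fin d → NCSeries d) :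
    comp (F + F') H = comp F H + comp F' H := by
  ext u; simp only [comp, add_apply, add_mul, sum_add_distrib]

theorem comp_smul (c : ℂ) (F : NCSeries d) (H : Fin d → NCSeries d) :
    comp (c • F) H = c • comp F H := by
  ext u; simp only [comp, smul_apply, mul_sum, mul_assoc]

theorem comp_zero (H : Fin d → NCSeries d) : comp 0 H = 0 := by
  ext u; simp [comp, zero_apply]

theorem comp_neg (F : NCSeries d) (H : Fin d → NCSeries d) : comp (-F) H = -comp F H := by
  ext u; simp [comp, neg_apply]

theorem comp_sub (F F' : NCSeries d) (H : Fin d → NCSeries d) :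
    comp (F - F') H = comp F H - comp F' H := by
  rw [sub_eq_add_neg, comp_add, comp_neg, ← sub_eq_add_neg]

theorem comp_sum {ι : Type*} (s : Finset ι) (F : ι → NCSeries d) (H : Fin d → NCSeries d) :
    comp (∑ i ∈ s, F i) H = ∑ i ∈ s, comp (F i) H := by
  classical
  induction s using Finset.induction_on with
  | empty => simp [comp_zero]
  | insert a s ha ih => rw [sum_insert ha, sum_insert ha, comp_add, ih]

theorem compTrunc_succ (n : ℕ) (F : NCSeries d) (H : Fin d → NCSeries d) :
    compTrunc (n + 1) F H = F [] • 1 + ∑ i, H i * compTrunc n (leftD i F) H := by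
  rw [compTrunc, sum_range_succ', add_comm]
  congr 1
  · simp
  · simp only [compTrunc, mul_sum]
    rw [sum_comm]
    refine sum_congr rfl fun k _ => ?_
    rw [← (Fin.consEquiv fun _ => Fin d).sum_comp, Fintype.sum_prod_type]
    refine sum_congr rfl fun i _ => sum_congr rfl fun v _ => ?_
    simp [Fin.consEquiv, List.ofFn_succ, leftD_apply, NCSeries.mul_smul']

theorem AgreeTo.mul_left_of_nil {n : ℕ} {H F G : NCSeries d} (hH : H [] = 0)
    (h : AgreeTo n F G) : AgreeTo (n + 1) (H * F) (H * G) := by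
  intro u hu
  cases u with
  | nil => simp [mul_nil, hH]
  | cons i u =>
    rw [mul_cons, mul_cons, hH, zero_mul, zero_mul,
      AgreeTo.mul (fun _ _ => rfl) h u (by simpa using hu)]

theorem comp_left_rec (F : NCSeries d) (H : Fin d → NCSeries d) (hH : ∀ i, H i [] = 0) :
    comp F H = F [] • 1 + ∑ i, H i * comp (leftD i F) H := by
  refine eq_of_agreeTo fun n u hu => ?_
  rw [agreeTo_comp F H hH (n + 1) u (by omega), compTrunc_succ, add_apply, add_apply, sum_apply,
    sum_apply]
  congr 1
  refine sum_congr rfl fun i _ => ?_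
  exact (AgreeTo.mul_left_of_nil (hH i) (agreeTo_comp (leftD i F) H hH n) u (by omega)).symm

theorem comp_right_rec (F : NCSeries d) (H : Fin d → NCSeries d) (hH : ∀ i, H i [] = 0) :
    comp F H = F [] • 1 + ∑ i, comp (rightD i F) H * H i := by
  have h := congrArg adj (comp_left_rec (adj F) (fun i => adj (H i))
    (fun i => by simp [adj_apply, hH]))
  rw [adj_comp, adj_add, adj_smul, adj_one, adj_sum] at h
  simpa only [adj_adj, adj_mul, adj_comp, adj_leftD, adj_apply, List.reverse_nil,
    Complex.conj_conj] using h

theorem comp_one (H : Fin d → NCSeries d) (hH : ∀ i, H i [] = 0) : comp 1 H = 1 := by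
  rw [comp_left_rec _ _ hH]
  simp [leftD_one, comp_zero, one_apply]

theorem comp_X (i : Fin d) (H : Fin d → NCSeries d) (hH : ∀ i, H i [] = 0) :
    comp (X i) H = H i := by
  rw [comp_left_rec _ _ hH]
  simp only [leftD_X, X_nil, zero_smul, zero_add]
  rw [sum_eq_single i]
  · simp [comp_one H hH]
  · intro j _ hj; simp [hj, comp_zero]
  · simp

theorem comp_mul (F G : NCSeries d) (H : Fin d → NCSeries d) (hH : ∀ i, H i [] = 0) :
    comp (F * G) H = comp F H * comp G H := by
  refine eq_of_agreeTo fun n => ?_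
  induction n generalizing F with
  | zero => intro u hu; simp at hu
  | succ n ih =>
    intro u hu
    have h1 : comp F H * comp G H = F [] • comp G H +
        ∑ i, H i * (comp (leftD i F) H * comp G H) := by
      conv_lhs => rw [comp_left_rec F H hH]
      rw [add_mul, NCSeries.smul_mul', one_mul, sum_mul]
      simp only [mul_assoc]
    have h2 : comp (F * G) H = F [] • comp G H + ∑ i, H i * comp (leftD i F * G) H := by
      rw [comp_left_rec (F * G) H hH, comp_left_rec G H hH]
      simp only [leftD_mul, comp_add, comp_smul, mul_add, sum_add_distrib, mul_nil,
        NCSeries.mul_smul', smul_add, smul_smul, smul_sum]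
      abel
    rw [h1, h2, add_apply, add_apply, sum_apply, sum_apply]
    congr 1
    exact sum_congr rfl fun i _ => AgreeTo.mul_left_of_nil (hH i) (ih _) u hu

theorem comp_comp (F : NCSeries d) (H K : Fin d → NCSeries d) (hH : ∀ i, H i [] = 0)
    (hK : ∀ i, K i [] = 0) : comp (comp F H) K = comp F fun i => comp (H i) K := by
  have hHK : ∀ i, comp (H i) K [] = 0 := fun i => by rw [comp_nil, hH]
  refine eq_of_agreeTo fun n => ?_
  induction n generalizing F with
  | zero => intro u hu; simp at hu
  | succ n ih =>
    intro u hu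
    rw [comp_left_rec F H hH, comp_left_rec F _ hHK, comp_add, comp_smul, comp_one K hK, comp_sum,
      add_apply, add_apply, sum_apply, sum_apply]
    congr 1
    refine sum_congr rfl fun i _ => ?_
    rw [comp_mul _ _ _ hK]
    exact AgreeTo.mul_left_of_nil (hHK i) (ih _) u hu

theorem comp_inv (F : NCSeries d) (H : Fin d → NCSeries d) (hF : F [] = 1)
    (hH : ∀ i, H i [] = 0) : comp (inv F) H = inv (comp F H) := by
  refine (inv_eq_of_mul_eq_one (by rw [comp_nil, hF]) ?_).symm
  rw [← comp_mul _ _ _ hH, mul_inv F hF, comp_one H hH]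

theorem comp_leftDilate_comp (F G K : NCSeries d) :
    comp (comp F (leftDilate G)) (leftDilate K) =
      comp F (leftDilate (comp G (leftDilate K) * K)) := by
  rw [comp_comp _ _ _ (leftDilate_nil G) (leftDilate_nil K)]
  congr 1
  funext i
  rw [leftDilate, comp_mul _ _ _ (leftDilate_nil K), comp_X _ _ (leftDilate_nil K), leftDilate,
    leftDilate, mul_assoc]

/-- A composition `F(G w)` is read off from the right. -/
theorem comp_leftDilate_concat (F G : NCSeries d) (u : List (Fin d)) (j : Fin d) :
    comp F (leftDilate G) (u ++ [j]) = (comp (rightD j F) (leftDilate G) * G) u := by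
  rw [comp_right_rec F _ (leftDilate_nil G), add_apply, sum_apply, sum_eq_single j]
  · rw [leftDilate, ← mul_assoc, mul_X_concat]; simp [smul_apply, one_apply]
  · intro i _ hi; rw [leftDilate, ← mul_assoc, mul_X_concat, if_neg hi.symm]
  · simp

theorem comp_leftDilate_left_rec (R G : NCSeries d) :
    comp R (leftDilate G) = R [] • 1 + G * ∑ i, X i * comp (leftD i R) (leftDilate G) := by
  rw [comp_left_rec R _ (leftDilate_nil G), mul_sum]
  simp only [leftDilate, mul_assoc]

theorem one_add_nil {M : NCSeries d} (hM : M [] = 0) : (1 + M) [] = 1 := by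
  simp [add_apply, one_apply, hM]

theorem condSeries_eq_sum (R M : NCSeries d) (hR : R [] = 0) (hM : M [] = 0) :
    condSeries R M = ∑ i, X i * comp (leftD i R) (leftDilate (1 + M)) := by
  rw [condSeries, comp_leftDilate_left_rec, hR, zero_smul, zero_add, ← mul_assoc,
    inv_mul _ (one_add_nil hM), one_mul]

theorem condSeries_cons (R M : NCSeries d) (hR : R [] = 0) (hM : M [] = 0) (i : Fin d)
    (u : List (Fin d)) :
    condSeries R M (i :: u) = comp (leftD i R) (leftDilate (1 + M)) u := by
  rw [condSeries_eq_sum R M hR hM, sum_apply, sum_eq_single i]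
  · rw [X_mul_cons, if_pos rfl]
  · intro j _ hj; rw [X_mul_cons, if_neg hj.symm]
  · simp

theorem condSeries_one (R M : NCSeries d) (hR : R [] = 0) (hM : M [] = 0) (i : Fin d) :
    condSeries R M [i] = R [i] := by
  rw [condSeries_cons R M hR hM, comp_nil, leftD_apply]

theorem comp_leftDilate_singleton (F M : NCSeries d) (hM : M [] = 0) (j : Fin d) :
    comp F (leftDilate (1 + M)) [j] = F [j] := by
  have := comp_leftDilate_concat F (1 + M) [] j
  rw [List.nil_append] at this
  rw [this, mul_nil, comp_nil, one_add_nil hM, mul_one]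
  rfl

theorem condSeries_two (R M : NCSeries d) (hR : R [] = 0) (hM : M [] = 0) (i j : Fin d) :
    condSeries R M [i, j] = R [i, j] := by
  rw [condSeries_cons R M hR hM, comp_leftDilate_singleton _ _ hM, leftD_apply]

theorem comp_leftDilate_pair (F M : NCSeries d) (hM : M [] = 0) (j k : Fin d) :
    comp F (leftDilate (1 + M)) [j, k] = F [j, k] + F [k] * M [j] := by
  have := comp_leftDilate_concat F (1 + M) [j] k
  rw [List.singleton_append] at this
  rw [this, mul_cons, mul_nil, comp_nil, one_add_nil hM, mul_one, leftD_apply,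
    comp_leftDilate_singleton _ _ hM]
  simp [rightD_apply, add_apply, one_apply]

theorem condSeries_three (R M : NCSeries d) (hR : R [] = 0) (hM : M [] = 0) (i j k : Fin d) :
    condSeries R M [i, j, k] = R [i, j, k] + R [i, k] * M [j] := by
  rw [condSeries_cons R M hR hM, comp_leftDilate_pair _ _ hM]; rfl

theorem condSeries_four (R M : NCSeries d) (hR : R [] = 0) (hM : M [] = 0) (i j k l : Fin d) :
    condSeries R M [i, j, k, l] =
      R [i, j, k, l] + R [i, k, l] * M [j] + R [i, j, l] * M [k] + R [i, l] * M [j, k] := by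
  have := comp_leftDilate_concat (leftD i R) (1 + M) [j, k] l
  simp only [List.cons_append, List.nil_append] at this
  rw [condSeries_cons R M hR hM, this, mul_cons, mul_cons, mul_nil]
  simp only [leftD_apply, comp_nil, one_add_nil hM, comp_leftDilate_singleton _ _ hM,
    comp_leftDilate_pair _ _ hM, rightD_apply]
  simp [add_apply, one_apply]

theorem comp_leftDilate_injective {F F' G : NCSeries d} (hG : G [] = 1)
    (h : comp F (leftDilate G) = comp F' (leftDilate G)) : F = F' := by
  refine eq_of_agreeTo fun n => ?_
  induction n with
  | zero => intro u hu; simp at hu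
  | succ n ih =>
    intro u hu
    have := congrFun h u
    rw [comp_leftDilate_apply F G hG, comp_leftDilate_apply F' G hG,
      sum_congr rfl fun k hk => sum_congr rfl fun v _ => by
        rw [ih (List.ofFn v) (by simp at hk ⊢; omega)]] at this
    exact add_left_cancel this

theorem etaOf_mul (M : NCSeries d) (hM : M [] = 0) : etaOf M * (1 + M) = M := by
  rw [etaOf, sub_mul, inv_mul _ (one_add_nil hM), one_mul, add_sub_cancel_left]

theorem mul_etaOf (M : NCSeries d) (hM : M [] = 0) : (1 + M) * etaOf M = M := by
  rw [etaOf, mul_sub, mul_inv _ (one_add_nil hM), mul_one, add_sub_cancel_left]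

theorem inv_one_add (M : NCSeries d) : inv (1 + M) = 1 - etaOf M := by
  rw [etaOf, sub_sub_cancel]

end NCSeries

/-! ### Positive semidefinite kernels -/

namespace Kernel

open scoped ComplexOrder

variable {n m : Type*}

/-- The sesquilinear form on finitely supported functions given by a kernel. -/
noncomputable def form (K : Matrix n n ℂ) : (n →₀ ℂ) →ₗ⋆[ℂ] (n →₀ ℂ) →ₗ[ℂ] ℂ :=
  LinearMap.mk₂'ₛₗ (starRingEnd ℂ) (RingHom.id ℂ)
    (fun x y => x.sum fun i a => y.sum fun j b => star a * K i j * b)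
    (fun x x' y => by
      classical
      rw [Finsupp.sum_add_index']
      · simp
      · intro i a a'; simp [add_mul, Finsupp.sum_add])
    (fun c x y => by
      rw [Finsupp.sum_smul_index' (by simp), smul_eq_mul, Finsupp.mul_sum]
      refine Finsupp.sum_congr fun i _ => ?_
      rw [Finsupp.mul_sum]
      refine Finsupp.sum_congr fun j _ => ?_
      simp [mul_assoc])
    (fun x y y' => by
      classical
      rw [← Finsupp.sum_add]
      refine Finsupp.sum_congr fun i _ => ?_
      rw [Finsupp.sum_add_index'] <;> simp [mul_add])
    (fun c x y => by
      rw [RingHom.id_apply, smul_eq_mul, Finsupp.mul_sum]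
      refine Finsupp.sum_congr fun i _ => ?_
      rw [Finsupp.sum_smul_index' (by simp), Finsupp.mul_sum]
      refine Finsupp.sum_congr fun j _ => ?_
      simp only [smul_eq_mul]; ring)

theorem form_apply (K : Matrix n n ℂ) (x y : n →₀ ℂ) :
    form K x y = x.sum fun i a => y.sum fun j b => star a * K i j * b := rfl

@[simp] theorem form_single (K : Matrix n n ℂ) (i j : n) (a b : ℂ) :
    form K (Finsupp.single i a) (Finsupp.single j b) = star a * K i j * b := by
  simp [form_apply]

theorem form_nonneg {K : Matrix n n ℂ} (hK : K.PosSemidef) (x : n →₀ ℂ) : 0 ≤ form K x x :=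
  hK.2 x

theorem form_conj {K : Matrix n n ℂ} (hK : K.IsHermitian) (x y : n →₀ ℂ) :
    conj (form K x y) = form K y x := by
  induction x using Finsupp.induction_linear with
  | zero => simp
  | add x x' hx hx' => simp [hx, hx']
  | single i a =>
    induction y using Finsupp.induction_linear with
    | zero => simp
    | add y y' hy hy' => simp only [map_add, hy, hy', LinearMap.add_apply]
    | single j b =>
      have := hK.apply j i
      simp only [form_single, map_mul, ← this]
      simp
      ring

theorem posSemidef_of_form {K : Matrix n n ℂ} (hK : K.PosSemidef) (v : m → n →₀ ℂ) :
    (Matrix.of fun a b => form K (v a) (v b)).PosSemidef := by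
  refine ⟨?_, fun x => ?_⟩
  · ext a b
    simpa using form_conj hK.1 (v b) (v a)
  · have h : form K (Finsupp.linearCombination ℂ v x) (Finsupp.linearCombination ℂ v x) =
        x.sum fun a s => x.sum fun b t => star s * form K (v a) (v b) * t := by
      simp only [Finsupp.linearCombination_apply, Finsupp.sum, map_sum, LinearMap.coe_sum,
        Finset.sum_apply, map_smul, LinearMap.map_smulₛₗ, LinearMap.smul_apply, smul_eq_mul,
        mul_sum]
      rw [sum_comm]
      refine sum_congr rfl fun a _ => sum_congr rfl fun b _ => ?_
      simp only [starRingEnd_apply]; ring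
    simpa only [Matrix.of_apply, ← h] using form_nonneg hK _

theorem posSemidef_gram {k : Type*} [Fintype k] (f : n → k → ℂ) :
    (Matrix.of fun a b => ∑ i, conj (f a i) * f b i).PosSemidef := by
  classical
  have := posSemidef_of_form (Matrix.PosSemidef.one (n := k) (R := ℂ))
    fun a => Finsupp.equivFunOnFinite.symm (f a)
  convert this using 1
  ext a b
  simp only [Matrix.of_apply, form_apply]
  rw [Finsupp.sum_fintype _ _ (by simp)]
  refine sum_congr rfl fun i _ => ?_
  rw [Finsupp.sum_fintype _ _ (by simp), sum_eq_single i]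
  · simp
  · intro j _ hj; simp [Matrix.one_apply_ne hj.symm]
  · simp

theorem posSemidef_of_finite {K : Matrix n n ℂ}
    (h : ∀ s : Finset n, (K.submatrix (Subtype.val : s → n) Subtype.val).PosSemidef) :
    K.PosSemidef := by
  classical
  refine ⟨?_, fun x => ?_⟩
  · ext i j
    exact (h {i, j}).1.apply ⟨i, by simp⟩ ⟨j, by simp⟩
  · have := (h x.support).2 (Finsupp.equivFunOnFinite.symm fun i => x i)
    rw [Finsupp.sum_fintype _ _ (by simp)] at this
    convert this using 1
    rw [Finsupp.sum, ← sum_coe_sort]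
    refine sum_congr rfl fun i _ => ?_
    rw [Finsupp.sum, ← sum_coe_sort, Finsupp.sum_fintype _ _ (by simp)]
    rfl

theorem posSemidef_hadamard {K L : Matrix n n ℂ} (hK : K.PosSemidef) (hL : L.PosSemidef) :
    (Matrix.of fun a b => K a b * L a b).PosSemidef :=
  posSemidef_of_finite fun s => by
    classical
    exact (hK.submatrix (Subtype.val : s → n)).hadamard (hL.submatrix Subtype.val)

theorem posSemidef_tensor {K : Matrix n n ℂ} {L : Matrix m m ℂ} (hK : K.PosSemidef)
    (hL : L.PosSemidef) :
    (Matrix.of fun a b : n × m => K a.1 b.1 * L a.2 b.2).PosSemidef :=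
  posSemidef_hadamard (hK.submatrix Prod.fst) (hL.submatrix Prod.snd)

theorem posSemidef_of_tendsto {ι : Type*} {l : Filter ι} [l.NeBot] {K : ι → Matrix n n ℂ}
    {L : Matrix n n ℂ} (hK : ∀ᶠ t in l, (K t).PosSemidef)
    (h : ∀ a b, Filter.Tendsto (fun t => K t a b) l (nhds (L a b))) : L.PosSemidef := by
  refine ⟨?_, fun x => ?_⟩
  · ext a b
    refine tendsto_nhds_unique_of_eventuallyEq ((h b a).star) (h a b) ?_
    filter_upwards [hK] with t ht using ht.1.apply a b
  · refine ge_of_tendsto (x := l)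
      (f := fun t => x.sum fun i a => x.sum fun j b => star a * K t i j * b) ?_ ?_
    · refine tendsto_finsetSum _ fun i _ => tendsto_finsetSum _ fun j _ => ?_
      exact ((h i j).const_mul _).mul_const _
    · filter_upwards [hK] with t ht using ht.2 x

/-- Vectors of length zero are orthogonal to everything. -/
theorem form_eq_zero_of_self {K : Matrix n n ℂ} (hK : K.PosSemidef) {x : n →₀ ℂ}
    (hx : form K x x = 0) (y : n →₀ ℂ) : form K y x = 0 := by
  by_contra h
  set z := form K y x with hz
  have hxy : form K x y = conj z := (form_conj hK.1 y x).symm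
  have key : ∀ t : ℝ, 0 ≤ (form K y y).re - 2 * t * Complex.normSq z := by
    intro t
    have h0 := form_nonneg hK (y - ((t : ℂ) * conj z) • x)
    have e : form K (y - ((t : ℂ) * conj z) • x) (y - ((t : ℂ) * conj z) • x) =
        form K y y - 2 * t * (Complex.normSq z : ℂ) := by
      simp only [map_sub, LinearMap.sub_apply, map_smul, LinearMap.map_smulₛₗ,
        LinearMap.smul_apply, hx, hxy, ← hz, smul_eq_mul, map_mul, Complex.conj_ofReal,
        Complex.conj_conj, Complex.normSq_eq_conj_mul_self]
      ring
    rw [e] at h0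
    have := (Complex.nonneg_iff.1 h0).1
    simpa [Complex.sub_re, Complex.mul_re] using this
  have hpos : 0 < Complex.normSq z := Complex.normSq_pos.2 h
  have := key (((form K y y).re + 1) / (2 * Complex.normSq z))
  have e : 2 * (((form K y y).re + 1) / (2 * Complex.normSq z)) * Complex.normSq z =
      (form K y y).re + 1 := by field_simp
  rw [e] at this
  linarith

/-! ### Kernels given by symmetric operators -/

theorem form_symm_of_single {K : Matrix n n ℂ} {Y : (n →₀ ℂ) →ₗ[ℂ] (n →₀ ℂ)}
    (h : ∀ a b, form K (Y (Finsupp.single a 1)) (Finsupp.single b 1) =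
      form K (Finsupp.single a 1) (Y (Finsupp.single b 1))) (x y : n →₀ ℂ) :
    form K (Y x) y = form K x (Y y) := by
  induction x using Finsupp.induction_linear with
  | zero => simp
  | add x x' hx hx' => simp [hx, hx']
  | single i a =>
    induction y using Finsupp.induction_linear with
    | zero => simp
    | add y y' hy hy' => simp only [map_add, hy, hy']
    | single j b =>
      have ea : Finsupp.single i a = a • Finsupp.single i (1 : ℂ) := by simp
      have eb : Finsupp.single j b = b • Finsupp.single j (1 : ℂ) := by simp
      rw [ea, eb]
      simp only [map_smul, LinearMap.map_smulₛₗ, LinearMap.smul_apply, h]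

variable {d : ℕ}

/-- The product of operators along a word. -/
noncomputable def opWord (Y : Fin d → Module.End ℂ (n →₀ ℂ)) (u : List (Fin d)) :
    Module.End ℂ (n →₀ ℂ) := (u.map Y).prod

theorem opWord_nil (Y : Fin d → Module.End ℂ (n →₀ ℂ)) : opWord Y [] = 1 := rfl

theorem opWord_append (Y : Fin d → Module.End ℂ (n →₀ ℂ)) (u v : List (Fin d)) (x : n →₀ ℂ) :
    opWord Y (u ++ v) x = opWord Y u (opWord Y v x) := by
  simp [opWord]

theorem opWord_singleton (Y : Fin d → Module.End ℂ (n →₀ ℂ)) (i : Fin d) :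
    opWord Y [i] = Y i := by
  simp [opWord]

theorem form_opWord {K : Matrix n n ℂ} {Y : Fin d → Module.End ℂ (n →₀ ℂ)}
    (h : ∀ i x y, form K (Y i x) y = form K x (Y i y)) (u : List (Fin d)) (x y : n →₀ ℂ) :
    form K (opWord Y u x) y = form K x (opWord Y u.reverse y) := by
  induction u generalizing x y with
  | nil => simp [opWord_nil]
  | cons i u ih =>
    rw [← List.singleton_append, opWord_append, opWord_singleton, h, ih, List.reverse_append,
      opWord_append, List.reverse_singleton, opWord_singleton]

theorem posSemidef_of_symmetric {K : Matrix n n ℂ} (hK : K.PosSemidef)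
    {Y : Fin d → Module.End ℂ (n →₀ ℂ)} (h : ∀ i x y, form K (Y i x) y = form K x (Y i y))
    (v : m → n →₀ ℂ) :
    (Matrix.of fun a b : List (Fin d) × m =>
      form K (v a.2) (opWord Y (a.1.reverse ++ b.1) (v b.2))).PosSemidef := by
  convert posSemidef_of_form hK fun a : List (Fin d) × m => opWord Y a.1 (v a.2) using 1
  ext a b
  simp only [Matrix.of_apply]
  rw [form_opWord h, opWord_append]

end Kernel

namespace NCSeries

open Kernel
open scoped ComplexOrder

variable {d : ℕ}

/-- The kernel `F(a* b)` on all words. -/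
def hankel (F : NCSeries d) : Matrix (List (Fin d)) (List (Fin d)) ℂ :=
  Matrix.of fun a b => F (a.reverse ++ b)

/-- The kernel `F((s i)* (t j))` on the non-empty words `s i`. -/
def condHankel (F : NCSeries d) : Matrix (List (Fin d) × Fin d) (List (Fin d) × Fin d) ℂ :=
  Matrix.of fun a b => F (a.2 :: (a.1.reverse ++ b.1 ++ [b.2]))

theorem hankel_apply (F : NCSeries d) (a b : List (Fin d)) : hankel F a b = F (a.reverse ++ b) :=
  rfl

theorem condHankel_apply (F : NCSeries d) (a b : List (Fin d) × Fin d) :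
    condHankel F a b = F (a.2 :: (a.1.reverse ++ b.1 ++ [b.2])) := rfl

/-- Conditional positivity: `F[P* P] ≥ 0` for polynomials `P` without constant term. -/
def CondPos (F : NCSeries d) : Prop := (condHankel F).PosSemidef

theorem condHankel_eq_submatrix (F : NCSeries d) :
    condHankel F = (hankel F).submatrix (fun a => a.1 ++ [a.2]) fun a => a.1 ++ [a.2] := by
  ext a b; simp [condHankel, hankel]

theorem condHankel_congr {F F' : NCSeries d} (h : ∀ u, 2 ≤ u.length → F u = F' u) :
    condHankel F = condHankel F' := by
  ext a b
  exact h _ (by simp; omega)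

theorem condPos_one_add {M : NCSeries d} (h : (hankel (1 + M)).PosSemidef) : CondPos M := by
  have := h.submatrix fun a : List (Fin d) × Fin d => a.1 ++ [a.2]
  rw [← condHankel_eq_submatrix] at this
  rwa [CondPos, ← condHankel_congr (F := 1 + M)]
  intro u hu
  have : u ≠ [] := by rintro rfl; simp at hu
  simp [add_apply, one_apply, this]

theorem CondPos.smul {F : NCSeries d} (h : CondPos F) {t : ℝ} (ht : 0 ≤ t) :
    CondPos ((t : ℂ) • F) := by
  have := Matrix.PosSemidef.smul h (a := (t : ℂ)) (by exact_mod_cast ht)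
  exact this

/-! ### Boolean cumulants of states -/

/-- The action of the variables on the Boolean Fock space over the kernel of `E`. -/
noncomputable def boolOp (E : NCSeries d) (i : Fin d) :
    Module.End ℂ (Option (List (Fin d) × Fin d) →₀ ℂ) :=
  Finsupp.linearCombination ℂ fun
    | none => Finsupp.single (some ([], i)) 1 + E [i] • Finsupp.single none 1
    | some (t, j) => Finsupp.single (some (i :: t, j)) 1 +
        E (i :: (t ++ [j])) • Finsupp.single none 1

/-- The direct sum of the scalars and the kernel of `E`. -/
def boolKernel (E : NCSeries d) :
    Matrix (Option (List (Fin d) × Fin d)) (Option (List (Fin d) × Fin d)) ℂ :=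
  Matrix.of fun
    | none, none => 1
    | some a, some b => condHankel E a b
    | _, _ => 0

theorem boolKernel_posSemidef {E : NCSeries d} (hE : CondPos E) : (boolKernel E).PosSemidef := by
  let f : Option (List (Fin d) × Fin d) → Unit → ℂ := fun a _ => if a = none then 1 else 0
  let v : Option (List (Fin d) × Fin d) → ((List (Fin d) × Fin d) →₀ ℂ) := fun
    | none => 0
    | some a => Finsupp.single a 1
  have := (posSemidef_gram f).add (posSemidef_of_form hE v)
  convert this using 1
  ext a b
  rcases a with _ | a <;> rcases b with _ | b <;> simp [boolKernel, f, v]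

theorem boolOp_symm {E : NCSeries d} (hE : adj E = E) (i : Fin d)
    (x y : Option (List (Fin d) × Fin d) →₀ ℂ) :
    form (boolKernel E) (boolOp E i x) y = form (boolKernel E) x (boolOp E i y) := by
  have hr : ∀ u, conj (E u) = E u.reverse := fun u => by
    conv_rhs => rw [← hE, adj_apply, List.reverse_reverse]
  refine form_symm_of_single (fun a b => ?_) x y
  rcases a with _ | ⟨s, k⟩ <;> rcases b with _ | ⟨t, j⟩ <;>
    simp [boolOp, boolKernel, condHankel_apply, hr]

theorem boolOp_none (E : NCSeries d) (i : Fin d) : boolOp E i (Finsupp.single none 1) =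
    Finsupp.single (some ([], i)) 1 + E [i] • Finsupp.single none 1 := by
  simp [boolOp]

theorem boolOp_some (E : NCSeries d) (i : Fin d) (t : List (Fin d)) (j : Fin d) :
    boolOp E i (Finsupp.single (some (t, j)) 1) =
      Finsupp.single (some (i :: t, j)) 1 + E (i :: (t ++ [j])) • Finsupp.single none 1 := by
  simp [boolOp]

theorem sum_take_drop_concat (G E : NCSeries d) (b : List (Fin d)) (i : Fin d)
    (w : List (Fin d)) :
    ∑ k ∈ range (b ++ [i]).length, G ((b ++ [i]).take k) * E ((b ++ [i]).drop k ++ w) =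
      (∑ k ∈ range b.length, G (b.take k) * E (b.drop k ++ (i :: w))) + G b * E (i :: w) := by
  rw [List.length_append, List.length_singleton, sum_range_succ]
  congr 1
  · refine sum_congr rfl fun k hk => ?_
    simp only [mem_range] at hk
    rw [List.take_append_of_le_length hk.le, List.drop_append_of_le_length hk.le]
    simp
  · simp

theorem moment_concat {E G : NCSeries d} (hG : G = 1 + G * E) (hE : E [] = 0)
    (b : List (Fin d)) (i : Fin d) : G (b ++ [i]) =
      (∑ k ∈ range b.length, G (b.take k) * E (b.drop k ++ [i])) + G b * E [i] := by
  have := sum_take_drop_concat G E b i []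
  simp only [List.append_nil] at this
  rw [← this]
  conv_lhs => rw [hG, add_apply, mul_apply, sum_range_succ]
  simp [one_apply, hE]

theorem boolOp_coeff {E G : NCSeries d} (hG : G = 1 + G * E) (hE : E [] = 0) (b : List (Fin d)) :
    opWord (boolOp E) b (Finsupp.single none 1) none = G b ∧
    ∀ t j, opWord (boolOp E) b (Finsupp.single (some (t, j)) 1) none =
      ∑ k ∈ range b.length, G (b.take k) * E (b.drop k ++ (t ++ [j])) := by
  induction b using List.reverseRecOn with
  | nil =>
    refine ⟨?_, fun t j => by simp [opWord_nil]⟩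
    rw [hG]; simp [opWord_nil, add_apply, one_apply, mul_nil, hE]
  | append_singleton b i ih =>
    constructor
    · rw [opWord_append, opWord_singleton, boolOp_none, map_add, map_smul, Finsupp.add_apply,
        Finsupp.smul_apply, ih.1, ih.2, moment_concat hG hE, List.nil_append, smul_eq_mul,
        mul_comm (E [i])]
    · intro t j
      rw [opWord_append, opWord_singleton, sum_take_drop_concat, boolOp_some, map_add, map_smul,
        Finsupp.add_apply, Finsupp.smul_apply, ih.1, ih.2, smul_eq_mul, mul_comm (E _)]
      rfl

/-- A functional with conditionally positive Boolean cumulants is a state. -/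
theorem hankel_posSemidef_of_condPos {M : NCSeries d} (hM : M [] = 0) (ha : adj M = M)
    (h : CondPos (etaOf M)) : (hankel (1 + M)).PosSemidef := by
  have hG : 1 + M = 1 + (1 + M) * etaOf M := by rw [mul_etaOf M hM]
  have := (posSemidef_of_symmetric (boolKernel_posSemidef h)
    (boolOp_symm (adj_etaOf M hM ha)) fun _ : Unit => Finsupp.single none 1).submatrix
      fun a : List (Fin d) => (a, ())
  convert this using 1
  ext a b
  have key : ∀ x, form (boolKernel (etaOf M)) (Finsupp.single none 1) x = x none := by
    intro x
    induction x using Finsupp.induction_linear with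
    | zero => simp
    | add x y hx hy => simp [hx, hy]
    | single c r => rcases c with _ | c <;> simp [boolKernel]
  simp only [Matrix.submatrix_apply, Matrix.of_apply, key]
  rw [(boolOp_coeff hG (etaOf_nil M) _).1, hankel_apply]

/-- Left multiplication of a polynomial by a variable. -/
noncomputable def shift (i : Fin d) : (List (Fin d) →₀ ℂ) →ₗ[ℂ] (List (Fin d) →₀ ℂ) :=
  Finsupp.lmapDomain ℂ ℂ (List.cons i)

/-- The polynomials `x_t x_j`, with the projection onto the orthogonal complement of `1` applied
after each multiplication. -/
noncomputable def compressed (G : NCSeries d) : List (Fin d) → Fin d → (List (Fin d) →₀ ℂ)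
  | [], j => Finsupp.single [j] 1 - G [j] • Finsupp.single [] 1
  | i :: t, j => shift i (compressed G t j) -
      form (hankel G) (Finsupp.single [i] 1) (compressed G t j) • Finsupp.single [] 1

theorem form_shift (G : NCSeries d) (a : List (Fin d)) (i : Fin d) (x : List (Fin d) →₀ ℂ) :
    form (hankel G) (Finsupp.single a 1) (shift i x) =
      form (hankel G) (Finsupp.single (i :: a) 1) x := by
  induction x using Finsupp.induction_linear with
  | zero => simp
  | add x y hx hy => simp only [map_add, hx, hy]
  | single c r => simp [shift, hankel_apply]

theorem form_shift_shift (G : NCSeries d) (i : Fin d) (x y : List (Fin d) →₀ ℂ) :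
    form (hankel G) (shift i x) y = form (hankel G) x (shift i y) :=
  form_symm_of_single (fun a b => by simp [shift, hankel_apply]) x y

theorem form_compressed {G E : NCSeries d} (hG : G = 1 + G * E) (hE : E [] = 0)
    (t : List (Fin d)) (j : Fin d) (a : List (Fin d)) :
    form (hankel G) (Finsupp.single a.reverse 1) (compressed G t j) =
      ∑ k ∈ range a.length, G (a.take k) * E (a.drop k ++ (t ++ [j])) := by
  have hG0 : G [] = 1 := by rw [hG]; simp [add_apply, one_apply, mul_nil, hE]
  induction t generalizing a with
  | nil =>
    have h3 := moment_concat hG hE [] j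
    simp [hG0] at h3
    simp only [compressed, map_sub, form_single, map_smul, hankel_apply, List.reverse_reverse,
      moment_concat hG hE a j, List.append_nil, List.nil_append, h3]
    simp [mul_comm]
  | cons i t ih =>
    have h1 := ih (a ++ [i])
    have h2 := ih [i]
    rw [sum_take_drop_concat] at h1
    simp only [List.reverse_append, List.reverse_singleton, List.singleton_append] at h1
    simp [hG0] at h2
    simp [compressed, form_shift, h1, h2, hankel_apply, mul_comm]

/-- The Boolean cumulants of a state are conditionally positive. -/
theorem condPos_etaOf {M : NCSeries d} (hM : M [] = 0) (h : (hankel (1 + M)).PosSemidef) :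
    CondPos (etaOf M) := by
  set G := 1 + M with hGM
  have hG : G = 1 + G * etaOf M := by rw [hGM, mul_etaOf M hM]
  have hE := etaOf_nil M
  have hG0 : G [] = 1 := one_add_nil hM
  have h0 : ∀ t j, form (hankel G) (Finsupp.single [] 1) (compressed G t j) = 0 := fun t j => by
    simpa using form_compressed hG hE t j []
  have h0' : ∀ t j, form (hankel G) (compressed G t j) (Finsupp.single [] 1) = 0 := fun t j => by
    rw [← form_conj h.1, h0, map_zero]
  have h1 : ∀ i t j, form (hankel G) (Finsupp.single [i] 1) (compressed G t j) =
      etaOf M (i :: (t ++ [j])) := fun i t j => by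
    simpa [hG0] using form_compressed hG hE t j [i]
  have key : ∀ s i t j, form (hankel G) (compressed G s i) (compressed G t j) =
      etaOf M (i :: (s.reverse ++ t ++ [j])) := by
    intro s
    induction s with
    | nil =>
      intro i t j
      simp only [compressed, map_sub, LinearMap.sub_apply, LinearMap.map_smulₛₗ,
        LinearMap.smul_apply, h0, h1]
      simp
    | cons k s ih =>
      intro i t j
      have e : form (hankel G) (compressed G s i) (shift k (compressed G t j)) =
          form (hankel G) (compressed G s i) (compressed G (k :: t) j) := by
        rw [compressed, map_sub, map_smul, h0', smul_zero, sub_zero]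
      rw [compressed, map_sub, LinearMap.sub_apply, LinearMap.map_smulₛₗ, LinearMap.smul_apply, h0,
        smul_zero, sub_zero, form_shift_shift, e, ih]
      simp
  have := posSemidef_of_form h fun a : List (Fin d) × Fin d => compressed G a.1 a.2
  rw [CondPos]
  convert this using 1
  ext a b
  simp only [Matrix.of_apply, key, condHankel_apply]

/-! ### Positivity of the conditional transformation -/

/-- The kernel on pairs of a gap and a non-empty word of chosen letters. -/
def gapKernel (R G : NCSeries d) :
    Matrix (List (Fin d) × (List (Fin d) × Fin d)) (List (Fin d) × (List (Fin d) × Fin d)) ℂ :=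
  Matrix.of fun a b => hankel G a.1 b.1 * condHankel R a.2 b.2

/-- A letter either extends the current gap, or is chosen and starts a new gap. -/
noncomputable def gapOp (G : NCSeries d) (i : Fin d) :
    Module.End ℂ (List (Fin d) × (List (Fin d) × Fin d) →₀ ℂ) :=
  Finsupp.linearCombination ℂ fun a => Finsupp.single (i :: a.1, a.2) 1 +
    G a.1 • Finsupp.single ([], (i :: a.2.1, a.2.2)) 1

theorem gapOp_single (G : NCSeries d) (i : Fin d) (a : List (Fin d) × (List (Fin d) × Fin d)) :
    gapOp G i (Finsupp.single a 1) = Finsupp.single (i :: a.1, a.2) 1 +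
      G a.1 • Finsupp.single ([], (i :: a.2.1, a.2.2)) 1 := by
  simp [gapOp]

theorem gapOp_symm {R G : NCSeries d} (hGa : adj G = G) (i : Fin d)
    (x y : List (Fin d) × (List (Fin d) × Fin d) →₀ ℂ) :
    form (gapKernel R G) (gapOp G i x) y = form (gapKernel R G) x (gapOp G i y) := by
  have hr : ∀ u, conj (G u) = G u.reverse := fun u => by
    conv_rhs => rw [← hGa, adj_apply, List.reverse_reverse]
  refine form_symm_of_single (fun a b => ?_) x y
  simp [gapOp_single, gapKernel, hankel_apply, condHankel_apply, hr]
  ring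

/-- The series with coefficients `F (u ++ w)`. -/
def rightShift (w : List (Fin d)) (F : NCSeries d) : NCSeries d := fun u => F (u ++ w)

theorem gapOp_eval {F G : NCSeries d} (L : (List (Fin d) × (List (Fin d) × Fin d) →₀ ℂ) →ₗ[ℂ] ℂ)
    (hL : ∀ q t j, L (Finsupp.single (q, (t, j)) 1) = F (t ++ [j]) * G q) (b : List (Fin d)) :
    ∀ q t j, L (opWord (gapOp G) b (Finsupp.single (q, (t, j)) 1)) =
      ∑ k ∈ range (b.length + 1),
        comp (rightShift (t ++ [j]) F) (leftDilate G) (b.take k) * G (b.drop k ++ q) := by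
  induction b using List.reverseRecOn with
  | nil => intro q t j; simp [opWord_nil, hL, comp_nil, rightShift]
  | append_singleton b i ih =>
    intro q t j
    rw [opWord_append, opWord_singleton, gapOp_single, map_add, map_add, map_smul, map_smul, ih, ih,
      List.length_append, List.length_singleton, sum_range_succ _ (b.length + 1)]
    congr 1
    · refine sum_congr rfl fun k hk => ?_
      simp only [mem_range] at hk
      rw [List.take_append_of_le_length (by omega), List.drop_append_of_le_length (by omega)]
      simp
    · rw [List.take_of_length_le (by simp), List.drop_of_length_le (by simp),
        comp_leftDilate_concat, mul_apply, smul_eq_mul, mul_comm, List.nil_append]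
      have e : rightD i (rightShift (t ++ [j]) F) = rightShift (i :: t ++ [j]) F := by
        ext s; simp [rightD_apply, rightShift]
      simp only [List.append_nil, e]

theorem condPos_condSeries {R M : NCSeries d} (hR : R [] = 0) (hM : M [] = 0) (ha : adj M = M)
    (hRp : CondPos R) (hMp : (hankel (1 + M)).PosSemidef) : CondPos (condSeries R M) := by
  have hGa : adj (1 + M) = 1 + M := by rw [adj_add, adj_one, ha]
  have := posSemidef_of_symmetric (posSemidef_tensor hMp hRp : (gapKernel R (1 + M)).PosSemidef)
    (gapOp_symm hGa) fun j : Fin d => Finsupp.single ([], ([], j)) 1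
  rw [CondPos]
  convert this using 1
  ext ⟨s, i⟩ ⟨t, j⟩
  simp only [Matrix.of_apply, condHankel_apply]
  rw [gapOp_eval (F := leftD i R) (G := 1 + M), condSeries_cons R M hR hM, comp_leftDilate_concat,
    mul_apply]
  · simp; rfl
  · intro q t j
    simp [hankel_apply, leftD_apply, mul_comm]

end NCSeries

namespace Functional

open NCSeries Kernel
open scoped ComplexOrder

variable {d : ℕ}

/-- The polynomial with given coefficients. -/
noncomputable def toPoly : (List (Fin d) →₀ ℂ) →ₗ[ℂ] NCPoly d :=
  Finsupp.linearCombination ℂ NCPoly.mon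

theorem toPoly_surjective : Function.Surjective (toPoly : (List (Fin d) →₀ ℂ) →ₗ[ℂ] NCPoly d) := by
  intro p
  induction p using MonoidAlgebra.induction_linear with
  | zero => exact ⟨0, map_zero _⟩
  | add p q hp hq =>
    obtain ⟨x, rfl⟩ := hp
    obtain ⟨y, rfl⟩ := hq
    exact ⟨x + y, map_add _ _ _⟩
  | single u c =>
    exact ⟨Finsupp.single u.toList c, by simp [toPoly, NCPoly.mon]⟩

theorem apply_adj_mul (φ : Functional d) (x y : List (Fin d) →₀ ℂ) :
    φ ((toPoly x).adj * toPoly y) = form (hankel (1 + φ.M)) x y := by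
  induction x using Finsupp.induction_linear with
  | zero => simp [NCPoly.adj]
  | add x x' hx hx' => simp only [map_add, NCPoly.adj_add, add_mul, hx, hx', LinearMap.add_apply]
  | single a r =>
    induction y using Finsupp.induction_linear with
    | zero => simp
    | add y y' hy hy' => simp only [map_add, mul_add, hy, hy']
    | single b s =>
      have e : (toPoly (Finsupp.single a r)).adj * toPoly (Finsupp.single b s) =
          (conj r * s) • NCPoly.mon (a.reverse ++ b) := by
        simp [toPoly, NCPoly.mon, NCPoly.adj_single, MonoidAlgebra.single_mul_single]
      rw [e, map_smul, apply_mon, form_single, hankel_apply, smul_eq_mul]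
      simp only [starRingEnd_apply]
      ring

theorem isHermitian_hankel {F : NCSeries d} (h : NCSeries.adj F = F) : (hankel F).IsHermitian := by
  ext a b
  have := congrFun h (a.reverse ++ b)
  simp only [NCSeries.adj_apply, List.reverse_append, List.reverse_reverse] at this
  simpa [hankel_apply] using this

theorem isState_iff (φ : Functional d) : φ.IsState ↔ (hankel (1 + φ.M)).PosSemidef := by
  have hn : ∀ z : ℂ, (0 ≤ z.re ∧ z.im = 0) ↔ 0 ≤ z := fun z => by
    rw [Complex.nonneg_iff, eq_comm (a := z.im)]
  simp only [IsState, hn]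
  constructor
  · intro h
    refine ⟨isHermitian_hankel (by rw [NCSeries.adj_add, NCSeries.adj_one, φ.adj_M]), fun x => ?_⟩
    have := h (toPoly x)
    rwa [apply_adj_mul] at this
  · intro h p
    obtain ⟨x, rfl⟩ := toPoly_surjective p
    rw [apply_adj_mul]
    exact form_nonneg h x

theorem isState_iff_condPos_eta (φ : Functional d) : φ.IsState ↔ φ.eta.CondPos := by
  rw [isState_iff]
  exact ⟨condPos_etaOf φ.M_nil, hankel_posSemidef_of_condPos φ.M_nil φ.adj_M⟩

theorem eta_Phi_eq (ρ ψ : Functional d) : (Phi ρ ψ).eta = condSeries ρ.R ψ.M := eta_Phi ρ ψ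

theorem isState_Phi {ρ ψ : Functional d} (hρ : ρ.R.CondPos) (hψ : ψ.IsState) :
    (Phi ρ ψ).IsState := by
  rw [isState_iff_condPos_eta, eta_Phi_eq]
  exact condPos_condSeries ρ.R_nil ψ.M_nil ψ.adj_M hρ ((isState_iff ψ).1 hψ)

end Functional

namespace NCSeries

variable {d : ℕ}

/-! ### Coefficientwise limits -/

/-- Coefficientwise convergence of series. -/
def TendsTo {ι : Type*} (F : ι → NCSeries d) (l : Filter ι) (G : NCSeries d) : Prop :=
  ∀ u, Filter.Tendsto (fun t => F t u) l (nhds (G u))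

section Limits

variable {ι : Type*} {l : Filter ι}

theorem TendsTo.const (F : NCSeries d) : TendsTo (fun _ : ι => F) l F := fun _ =>
  tendsto_const_nhds

theorem TendsTo.add {F F' : ι → NCSeries d} {G G' : NCSeries d} (h : TendsTo F l G)
    (h' : TendsTo F' l G') : TendsTo (fun t => F t + F' t) l (G + G') := fun u => (h u).add (h' u)

theorem TendsTo.sub {F F' : ι → NCSeries d} {G G' : NCSeries d} (h : TendsTo F l G)
    (h' : TendsTo F' l G') : TendsTo (fun t => F t - F' t) l (G - G') := fun u => (h u).sub (h' u)

theorem TendsTo.mul {F F' : ι → NCSeries d} {G G' : NCSeries d} (h : TendsTo F l G)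
    (h' : TendsTo F' l G') : TendsTo (fun t => F t * F' t) l (G * G') := fun u => by
  simp only [mul_apply]
  exact tendsto_finsetSum _ fun k _ => (h _).mul (h' _)

theorem TendsTo.list_prod {α : Type*} (L : List α) {F : α → ι → NCSeries d} {G : α → NCSeries d}
    (h : ∀ a, TendsTo (F a) l (G a)) :
    TendsTo (fun t => (L.map fun a => F a t).prod) l (L.map G).prod := by
  induction L with
  | nil => exact TendsTo.const 1
  | cons a L ih => simpa using (h a).mul ih

theorem TendsTo.pow {F : ι → NCSeries d} {G : NCSeries d} (h : TendsTo F l G) (n : ℕ) :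
    TendsTo (fun t => F t ^ n) l (G ^ n) := by
  induction n with
  | zero => simpa using TendsTo.const 1
  | succ n ih => simpa only [pow_succ] using ih.mul h

theorem TendsTo.inv {F : ι → NCSeries d} {G : NCSeries d} (h : TendsTo F l G) :
    TendsTo (fun t => inv (F t)) l (inv G) := fun u =>
  tendsto_finsetSum _ fun k _ => ((TendsTo.const 1).sub h).pow k u

theorem TendsTo.comp {F : ι → NCSeries d} {G : NCSeries d} {H : ι → Fin d → NCSeries d}
    {K : Fin d → NCSeries d} (h : TendsTo F l G) (hH : ∀ i, TendsTo (fun t => H t i) l (K i)) :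
    TendsTo (fun t => comp (F t) (H t)) l (comp G K) := fun u => by
  refine tendsto_finsetSum _ fun k _ => tendsto_finsetSum _ fun v _ => (h _).mul ?_
  have := TendsTo.list_prod (List.ofFn v) hH u
  simpa only [List.map_ofFn, Function.comp_def] using this

theorem TendsTo.leftDilate {F : ι → NCSeries d} {G : NCSeries d} (h : TendsTo F l G) (i : Fin d) :
    TendsTo (fun t => leftDilate (F t) i) l (leftDilate G i) := h.mul (TendsTo.const _)

end Limits

theorem comp_id (F : NCSeries d) : comp F (leftDilate 1) = F := by
  ext u
  induction u using List.reverseRecOn generalizing F with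
  | nil => rw [comp_nil]
  | append_singleton u i ih => rw [comp_leftDilate_concat, mul_one, ih, rightD_apply]

theorem tendsTo_momentOfFree (R : NCSeries d) :
    TendsTo (fun s : ℝ => momentOfFree ((s : ℂ) • R)) (nhds 0) 0 := by
  have key : ∀ n : ℕ, ∀ u : List (Fin d), u.length < n →
      Filter.Tendsto (fun s : ℝ => momentOfFree ((s : ℂ) • R) u) (nhds 0) (nhds 0) := by
    intro n
    induction n with
    | zero => intro u hu; simp at hu
    | succ n ih =>
      intro u hu
      have e : ∀ s : ℝ, momentOfFree ((s : ℂ) • R) u =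
          s * comp R (leftDilate (1 + momentOfFree ((s : ℂ) • R))) u := fun s => by
        conv_lhs => rw [← momentOfFree_spec]
        rw [comp_smul, smul_apply]
      let T : ℝ → NCSeries d := fun s v =>
        if v.length < n then momentOfFree ((s : ℂ) • R) v else 0
      have hT : TendsTo T (nhds 0) 0 := by
        intro v
        by_cases hv : v.length < n
        · simpa [T, hv, zero_apply] using ih v hv
        · simp only [T, hv, if_false]; exact tendsto_const_nhds
      have e' : ∀ s : ℝ, comp R (leftDilate (1 + momentOfFree ((s : ℂ) • R))) u =
          comp R (leftDilate (1 + T s)) u := fun s => by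
        refine contracting_momentOfFree R n _ _ (fun v hv => ?_) u hu
        simp [T, hv]
      simp only [e, e']
      have h1 := (TendsTo.const R).comp (fun i => ((TendsTo.const 1).add hT).leftDilate i) u
      have h2 : Filter.Tendsto (fun s : ℝ => (s : ℂ)) (nhds 0) (nhds ((0 : ℝ) : ℂ)) :=
        Complex.continuous_ofReal.tendsto 0
      simpa using h2.mul h1
  exact fun u => key _ u (Nat.lt_succ_self _)

theorem tendsTo_momentOfFree_div (R : NCSeries d) :
    TendsTo (fun s : ℝ => ((s⁻¹ : ℝ) : ℂ) • momentOfFree ((s : ℂ) • R)) (nhdsWithin 0 {0}ᶜ) R := by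
  have h : TendsTo (fun s : ℝ => comp R (leftDilate (1 + momentOfFree ((s : ℂ) • R))))
      (nhds 0) R := by
    have := (TendsTo.const R).comp
      (fun i => ((TendsTo.const 1).add (tendsTo_momentOfFree R)).leftDilate i)
    rwa [add_zero, comp_id] at this
  intro u
  refine ((h u).mono_left nhdsWithin_le_nhds).congr' ?_
  filter_upwards [self_mem_nhdsWithin] with s hs
  have hs' : (s : ℂ) ≠ 0 := by exact_mod_cast hs
  have e : momentOfFree ((s : ℂ) • R) =
      (s : ℂ) • comp R (leftDilate (1 + momentOfFree ((s : ℂ) • R))) := by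
    conv_lhs => rw [← momentOfFree_spec]
    rw [comp_smul]
  conv_rhs => rw [e]
  rw [smul_smul]
  simp [hs']

end NCSeries

namespace Functional

open NCSeries Kernel
open scoped ComplexOrder

variable {d : ℕ}

theorem M_freePow (ρ : Functional d) (t : ℝ) :
    (ρ.freePow t).M = momentOfFree ((t : ℂ) • ρ.R) := by
  rw [freePow, ofR, M_ofM]

theorem R_freePow (ρ : Functional d) (t : ℝ) : (ρ.freePow t).R = (t : ℂ) • ρ.R := R_ofR _ _ _

theorem R_freeConv (φ ψ : Functional d) : (freeConv φ ψ).R = φ.R + ψ.R := R_ofR _ _ _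

theorem eta_boolConv (φ ψ : Functional d) : (boolConv φ ψ).eta = φ.eta + ψ.eta := eta_ofEta _ _ _

theorem eta_boolPow (φ : Functional d) (t : ℝ) : (boolPow φ t).eta = (t : ℂ) • φ.eta :=
  eta_ofEta _ _ _

theorem Phi_self (ρ : Functional d) : Phi ρ ρ = ρ := by
  apply ext_eta
  rw [eta_Phi_eq, condSeries, R_spec]
  rw [eta]
  conv_lhs => rw [← mul_etaOf ρ.M ρ.M_nil]
  rw [← mul_assoc]
  conv_lhs => rw [mul_etaOf ρ.M ρ.M_nil, inv_mul _ (one_add_nil ρ.M_nil), one_mul]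

theorem IsFreelyInfDiv.condPos {ρ : Functional d} (h : ρ.IsFreelyInfDiv) : ρ.R.CondPos := by
  have hlim := tendsTo_momentOfFree_div ρ.R
  refine posSemidef_of_tendsto (l := nhdsWithin (0 : ℝ) (Set.Ioi 0))
    (K := fun s : ℝ => condHankel (((s⁻¹ : ℝ) : ℂ) • momentOfFree ((s : ℂ) • ρ.R))) ?_ ?_
  · filter_upwards [self_mem_nhdsWithin] with s hs
    have h1 := (isState_iff _).1 (h s (le_of_lt hs))
    rw [M_freePow] at h1
    exact (condPos_one_add h1).smul (inv_nonneg.2 (le_of_lt hs))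
  · intro a b
    exact (hlim _).mono_left (nhdsWithin_mono _ fun s hs => ne_of_gt hs)

/-! ### Point masses -/

/-- The linear series with coefficients `a`. -/
noncomputable def linSeries (a : Fin d → ℝ) : NCSeries d := ∑ i, (a i : ℂ) • X i

theorem linSeries_nil (a : Fin d → ℝ) : linSeries a [] = 0 := by
  rw [linSeries, sum_apply]
  exact sum_eq_zero fun i _ => by rw [smul_apply, X_nil, mul_zero]

theorem linSeries_singleton (a : Fin d → ℝ) (i : Fin d) : linSeries a [i] = a i := by
  rw [linSeries, sum_apply, sum_eq_single i]
  · simp [NCSeries.smul_apply, X, -Complex.coe_smul]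
  · intro j _ hj
    rw [NCSeries.smul_apply, X, if_neg (by simpa using hj.symm), mul_zero]
  · simp

theorem linSeries_of_two_le (a : Fin d → ℝ) (u : List (Fin d)) (hu : 2 ≤ u.length) :
    linSeries a u = 0 := by
  rw [linSeries, sum_apply]
  refine sum_eq_zero fun i _ => ?_
  have : u ≠ [i] := by rintro rfl; simp at hu
  simp [smul_apply, X, this]

theorem linSeries_mul_cons (a : Fin d → ℝ) (F : NCSeries d) (i : Fin d) (u : List (Fin d)) :
    (linSeries a * F) (i :: u) = a i * F u := by
  rw [linSeries, sum_mul, sum_apply, sum_eq_single i]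
  · rw [NCSeries.smul_mul', smul_apply, X_mul_cons, if_pos rfl]
  · intro j _ hj; rw [NCSeries.smul_mul', smul_apply, X_mul_cons, if_neg hj.symm, mul_zero]
  · simp

theorem M_delta (a : Fin d → ℝ) : (delta a).M = deltaSeries a := M_ofM _ _ _

theorem one_add_M_delta_apply (a : Fin d → ℝ) (u : List (Fin d)) :
    (1 + (delta a).M) u = ((u.map a).prod : ℝ) := by
  rw [M_delta, add_apply, one_apply, deltaSeries]
  by_cases h : u = [] <;> simp [h]

theorem one_sub_linSeries_mul (a : Fin d → ℝ) : (1 - linSeries a) * (1 + (delta a).M) = 1 := by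
  rw [sub_mul, one_mul, sub_eq_iff_eq_add]
  ext u
  cases u with
  | nil => simp [add_apply, mul_nil, linSeries_nil, M_nil]
  | cons i u =>
    rw [add_apply (1 : NCSeries d) (_ * _), linSeries_mul_cons, one_add_M_delta_apply,
      one_add_M_delta_apply, one_apply]
    simp

theorem inv_one_add_M_delta (a : Fin d → ℝ) : inv (1 + (delta a).M) = 1 - linSeries a := by
  have h := congrArg (· * inv (1 + (delta a).M)) (one_sub_linSeries_mul a)
  simp only [mul_assoc, mul_inv _ (one_add_nil (M_nil _)), mul_one, one_mul] at h
  exact h.symm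

theorem eta_delta (a : Fin d → ℝ) : (delta a).eta = linSeries a := by
  rw [eta, etaOf, inv_one_add_M_delta, sub_sub_cancel]

theorem comp_linSeries (a : Fin d → ℝ) (G : NCSeries d) :
    comp (linSeries a) (leftDilate G) = G * linSeries a := by
  simp only [linSeries, comp_sum, comp_smul, comp_X _ _ (leftDilate_nil G), leftDilate, mul_sum,
    NCSeries.mul_smul']

theorem R_delta (a : Fin d → ℝ) : (delta a).R = linSeries a := by
  refine (freeOf_unique _ _ (M_nil _) ?_).symm
  rw [comp_linSeries, ← eta_delta, eta, mul_etaOf _ (M_nil _)]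

theorem condPos_of_linear {F : NCSeries d} (h : ∀ u, 2 ≤ u.length → F u = 0) : CondPos F := by
  have : condHankel F = 0 := by
    ext a b
    exact h _ (by simp; omega)
  rw [CondPos, this]
  exact Matrix.PosSemidef.zero

theorem isState_delta (a : Fin d → ℝ) : (delta a).IsState := by
  rw [isState_iff_condPos_eta, eta_delta]
  exact condPos_of_linear (linSeries_of_two_le a)

theorem delta_zero_M : (delta (0 : Fin d → ℝ)).M = 0 := by
  rw [M_delta]
  ext u
  cases u <;> simp [deltaSeries, zero_apply]

theorem Phi_delta_left (a : Fin d → ℝ) (ψ : Functional d) : Phi (delta a) ψ = delta a := by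
  apply ext_eta
  rw [eta_Phi_eq, condSeries, R_delta, comp_linSeries, eta_delta, ← mul_assoc,
    inv_mul _ (one_add_nil ψ.M_nil), one_mul]

theorem eq_delta_of_R {ρ : Functional d} (h : ∀ u, 2 ≤ u.length → ρ.R u = 0) :
    ρ = delta fun i => (ρ.R [i]).re := by
  apply ext_R
  rw [R_delta]
  ext u
  match u with
  | [] => rw [linSeries_nil, R_nil]
  | [i] =>
    rw [linSeries_singleton]
    have := congrFun ρ.adj_R [i]
    simp only [NCSeries.adj_apply, List.reverse_singleton] at this
    exact (Complex.conj_eq_iff_re.1 this).symm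
  | i :: j :: u => rw [h _ (by simp), linSeries_of_two_le _ _ (by simp)]

/-! ### Free infinite divisibility -/

theorem condSeries_agreeTo (R : NCSeries d) {M M' : NCSeries d} (hR : R [] = 0) (hM : M [] = 0)
    (hM' : M' [] = 0) {n : ℕ} (h : AgreeTo n M M') :
    AgreeTo (n + 1) (condSeries R M) (condSeries R M') := by
  intro u hu
  cases u with
  | nil => rw [condSeries_nil _ _ hR, condSeries_nil _ _ hR]
  | cons i u =>
    rw [condSeries_cons R M hR hM, condSeries_cons R M' hR hM']
    exact contracting_momentOfFree _ n _ _ h u (by simp at hu; omega)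

theorem momentOfEta_agreeTo {E E' : NCSeries d} {n : ℕ} (h : AgreeTo n E E') :
    AgreeTo n (momentOfEta E) (momentOfEta E') := by
  have h1 : AgreeTo n (1 - E) (1 - E') := fun u hu => by rw [sub_apply, sub_apply, h u hu]
  have hp : ∀ k, AgreeTo n ((1 - (1 - E)) ^ k) ((1 - (1 - E')) ^ k) := by
    intro k
    induction k with
    | zero => intro u _; rfl
    | succ k ih =>
      rw [pow_succ, pow_succ]
      exact ih.mul fun u hu => by rw [sub_apply, sub_apply 1 (1 - E'), h1 u hu]
  intro u hu
  rw [momentOfEta, momentOfEta, sub_apply, sub_apply]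
  congr 1
  exact sum_congr rfl fun k _ => hp k u hu

theorem M_eq_momentOfEta (φ : Functional d) : φ.M = momentOfEta φ.eta :=
  (momentOfEta_etaOf φ.M φ.M_nil).symm

theorem Phi_agreeTo (ρ : Functional d) {ψ ψ' : Functional d} {n : ℕ} (h : AgreeTo n ψ.M ψ'.M) :
    AgreeTo (n + 1) (Phi ρ ψ).M (Phi ρ ψ').M := by
  rw [M_eq_momentOfEta, M_eq_momentOfEta]
  refine momentOfEta_agreeTo ?_
  rw [eta_Phi_eq, eta_Phi_eq]
  exact condSeries_agreeTo _ ρ.R_nil ψ.M_nil ψ'.M_nil h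

/-- A functional with conditionally positive free cumulants is a state. -/
theorem isState_of_condPos_R {ρ : Functional d} (h : ρ.R.CondPos) : ρ.IsState := by
  have hs : ∀ n, ((Phi ρ)^[n] (delta 0)).IsState := by
    intro n
    induction n with
    | zero => exact isState_delta 0
    | succ n ih => rw [Function.iterate_succ_apply']; exact isState_Phi h ih
  have ha : ∀ n, AgreeTo n ((Phi ρ)^[n] (delta 0)).M ρ.M := by
    intro n
    induction n with
    | zero => intro u hu; simp at hu
    | succ n ih =>
      rw [Function.iterate_succ_apply']
      have := Phi_agreeTo ρ ih
      rwa [Phi_self] at this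
  rw [isState_iff]
  refine posSemidef_of_tendsto (l := Filter.atTop)
    (K := fun n => hankel (1 + ((Phi ρ)^[n] (delta 0)).M))
    (Filter.Eventually.of_forall fun n => (isState_iff _).1 (hs n)) fun a b => ?_
  refine tendsto_const_nhds.congr' ?_
  filter_upwards [Filter.eventually_gt_atTop (a.reverse ++ b).length] with n hn
  rw [hankel_apply, hankel_apply, add_apply, add_apply, ha n _ hn]

theorem isFreelyInfDiv_iff (ρ : Functional d) : ρ.IsFreelyInfDiv ↔ ρ.R.CondPos := by
  refine ⟨IsFreelyInfDiv.condPos, fun h t ht => isState_of_condPos_R ?_⟩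
  rw [R_freePow]
  exact h.smul ht

/-! ### Mean, covariance and fixed points -/

theorem Phi_injective_left {ρ ρ' ψ : Functional d} (h : Phi ρ ψ = Phi ρ' ψ) : ρ = ρ' := by
  have h1 : condSeries ρ.R ψ.M = condSeries ρ'.R ψ.M := by rw [← eta_Phi_eq, h, eta_Phi_eq]
  have h2 := congrArg (fun F => (1 + ψ.M) * F) h1
  simp only [condSeries, ← mul_assoc, mul_inv _ (one_add_nil ψ.M_nil), one_mul] at h2
  exact ext_R (comp_leftDilate_injective (one_add_nil ψ.M_nil) h2)

theorem Phi_eq_right_iff (ρ ψ : Functional d) : Phi ρ ψ = ψ ↔ ψ = ρ := by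
  constructor
  · intro h
    exact (Phi_injective_left (h.trans (Phi_self ψ).symm)).symm
  · rintro rfl
    exact Phi_self ψ

theorem eta_singleton (φ : Functional d) (i : Fin d) : φ.eta [i] = φ.R [i] := by
  conv_lhs => rw [← Phi_self φ, eta_Phi_eq, condSeries_one _ _ φ.R_nil φ.M_nil]

theorem eta_pair (φ : Functional d) (i j : Fin d) : φ.eta [i, j] = φ.R [i, j] := by
  conv_lhs => rw [← Phi_self φ, eta_Phi_eq, condSeries_two _ _ φ.R_nil φ.M_nil]

theorem M_singleton (φ : Functional d) (i : Fin d) : φ.M [i] = φ.eta [i] := by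
  conv_lhs => rw [← etaOf_mul φ.M φ.M_nil]
  rw [mul_cons, mul_nil, etaOf_nil, zero_mul, add_zero, one_add_nil φ.M_nil, mul_one]
  rfl

theorem M_pair (φ : Functional d) (i j : Fin d) :
    φ.M [i, j] = φ.eta [i, j] + φ.M [i] * φ.M [j] := by
  conv_lhs => rw [← etaOf_mul φ.M φ.M_nil]
  rw [mul_cons, mul_cons, mul_nil, etaOf_nil, zero_mul, add_zero, one_add_nil φ.M_nil, mul_one,
    M_singleton]
  simp [leftD_apply, add_apply, one_apply, eta]

theorem mean_apply (φ : Functional d) (i : Fin d) : φ.mean i = φ.eta [i] := by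
  rw [← M_singleton]; simp [mean, M, NCPoly.x]

theorem cov_apply (φ : Functional d) (i j : Fin d) : φ.cov i j = φ.eta [i, j] := by
  have h := M_pair φ i j
  simp only [M, List.cons_ne_nil, if_false] at h
  rw [cov, Matrix.of_apply, NCPoly.x, NCPoly.x, NCPoly.mon_mul, List.singleton_append, h,
    add_sub_cancel_right]

theorem mean_Phi (ρ ψ : Functional d) : (Phi ρ ψ).mean = ρ.mean := by
  funext i
  rw [mean_apply, mean_apply, eta_Phi_eq, condSeries_one _ _ ρ.R_nil ψ.M_nil, eta_singleton]

theorem cov_Phi (ρ ψ : Functional d) : (Phi ρ ψ).cov = ρ.cov := by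
  ext i j
  rw [cov_apply, cov_apply, eta_Phi_eq, condSeries_two _ _ ρ.R_nil ψ.M_nil, eta_pair]

end Functional

namespace NCSeries

variable {d : ℕ}

/-! ### Insertion of a block into words -/

theorem append_lt_append_iff {α : Type*} [LinearOrder α] {a a' b b' : List α}
    (h : a.length = a'.length) : a ++ b < a' ++ b' ↔ a < a' ∨ a = a' ∧ b < b' := by
  induction a generalizing a' with
  | nil =>
    obtain rfl : a' = [] := List.length_eq_zero_iff.1 h.symm
    simp
  | cons x a ih =>
    cases a' with
    | nil => simp at h
    | cons y a' =>
      simp only [List.cons_append, List.cons_lt_cons_iff, ih (Nat.succ.inj h), List.cons.injEq]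
      tauto

theorem insert_lt_insert {α : Type*} [LinearOrder α] {p p' s s' v v' : List α}
    (hp : p.length = p'.length) (hv : v.length = v'.length) (hu : p ++ s ≤ p' ++ s')
    (hle : v ≤ v') (hne : ¬(p ++ s = p' ++ s' ∧ v = v')) :
    p ++ (v ++ s) < p' ++ (v' ++ s') := by
  rw [append_lt_append_iff hp, append_lt_append_iff hv]
  rcases hu.lt_or_eq with h | h
  · rcases (append_lt_append_iff hp).1 h with h | ⟨h, h'⟩
    · exact Or.inl h
    · rcases hle.lt_or_eq with h2 | h2
      · exact Or.inr ⟨h, Or.inl h2⟩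
      · exact Or.inr ⟨h, Or.inr ⟨h2, h'⟩⟩
  · obtain ⟨h1, h2⟩ := List.append_inj h hp
    exact Or.inr ⟨h1, Or.inl (hle.lt_of_ne fun e => hne ⟨h, e⟩)⟩

theorem exists_max_word (P : NCSeries d) (n : ℕ) (h : ∃ u, u.length = n ∧ P u ≠ 0) :
    ∃ u : List (Fin d), u.length = n ∧ P u ≠ 0 ∧ ∀ v, v.length = n → P v ≠ 0 → v ≤ u := by
  obtain ⟨u, hu, hm⟩ := Set.exists_max_image {u : List (Fin d) | u.length = n ∧ P u ≠ 0} id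
    ((List.finite_length_eq (Fin d) n).subset fun u hu => hu.1) h
  exact ⟨u, hu.1, hu.2, fun v hv hv' => hm v ⟨hv, hv'⟩⟩

/-- The insertion of a homogeneous polynomial `Q` before each letter of a homogeneous polynomial
`P` is not zero unless `P` or `Q` is. -/
theorem exists_insertion_ne_zero (P Q : NCSeries d) {n m : ℕ} (hn : 1 ≤ n)
    (hP : ∃ u, u.length = n ∧ P u ≠ 0) (hQ : ∃ v, v.length = m ∧ Q v ≠ 0) :
    ∃ W : List (Fin d), W.length = n + m ∧
      ∑ k ∈ range n, P (W.take k ++ W.drop (k + m)) * Q ((W.drop k).take m) ≠ 0 := by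
  obtain ⟨u, hul, hu, hum⟩ := exists_max_word P n hP
  obtain ⟨v, hvl, hv, hvm⟩ := exists_max_word Q m hQ
  obtain ⟨k₀, hk₀, hmax⟩ := exists_max_image (range n)
    (fun k => u.take k ++ (v ++ u.drop k)) ⟨0, by simp; omega⟩
  simp only [mem_range] at hk₀ hmax
  set W := u.take k₀ ++ (v ++ u.drop k₀) with hW
  have hWl : W.length = n + m := by simp [hW, hul, hvl]; omega
  refine ⟨W, hWl, ?_⟩
  have hpart : ∀ k, W.take k ++ ((W.drop k).take m ++ W.drop (k + m)) = W := by
    intro k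
    rw [← List.drop_drop, List.take_append_drop, List.take_append_drop]
  have hterm : ∀ k ∈ range n, P (W.take k ++ W.drop (k + m)) * Q ((W.drop k).take m) =
      if W.take k ++ W.drop (k + m) = u ∧ (W.drop k).take m = v then P u * Q v else 0 := by
    intro k hk
    simp only [mem_range] at hk
    split_ifs with h
    · rw [h.1, h.2]
    · by_contra hne
      have h1 : W.take k ++ W.drop (k + m) ≤ u :=
        hum _ (by simp [hWl]; omega) (left_ne_zero_of_mul hne)
      have h2 : (W.drop k).take m ≤ v := hvm _ (by simp [hWl]; omega) (right_ne_zero_of_mul hne)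
      have h3 := insert_lt_insert (p := W.take k) (s := W.drop (k + m))
        (v := (W.drop k).take m) (p' := u.take k) (s' := u.drop k) (v' := v)
        (by simp [hWl, hul]; omega) (by simp [hWl, hvl]; omega)
        (by rwa [List.take_append_drop]) h2 (by rwa [List.take_append_drop])
      rw [hpart] at h3
      exact absurd (hmax k hk) (not_le.2 h3)
  rw [sum_congr rfl hterm, ← sum_filter, sum_const, nsmul_eq_mul]
  refine mul_ne_zero (Nat.cast_ne_zero.2 (card_ne_zero.2 ⟨k₀, ?_⟩)) (mul_ne_zero hu hv)
  have hl : (u.take k₀).length = k₀ := by simp [hul]; omega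
  rw [mem_filter, mem_range]
  refine ⟨hk₀, ?_, ?_⟩
  · rw [hW, List.take_left' hl, ← List.drop_drop, List.drop_left' hl, List.drop_left' hvl,
      List.take_append_drop]
  · rw [hW, List.drop_left' hl, List.take_left' hvl]

theorem comp_apply_of_vanish {F G : NCSeries d} (hG : G [] = 1) {n : ℕ}
    (hF : ∀ u, u.length < n → F u = 0) (u : List (Fin d)) (hu : u.length ≤ n) :
    comp F (leftDilate G) u = F u := by
  rw [comp_leftDilate_apply F G hG, sum_eq_zero, zero_add]
  intro k hk
  refine sum_eq_zero fun v _ => ?_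
  rw [hF _ (by simp at hk ⊢; omega), zero_mul]

/-- The lowest order term of the difference of two compositions. -/
theorem comp_sub_comp {G G' : NCSeries d} (hG : G [] = 1) (hG' : G' [] = 1) {m : ℕ}
    (hm : 1 ≤ m) (h : AgreeTo m G G') (n : ℕ) (F : NCSeries d)
    (hF : ∀ u, u.length < n → F u = 0) :
    AgreeTo (n + m) (comp F (leftDilate G)) (comp F (leftDilate G')) ∧
    ∀ W, W.length = n + m → comp F (leftDilate G) W - comp F (leftDilate G') W =
      ∑ k ∈ range n, F (W.take k ++ W.drop (k + m)) * (G - G') ((W.drop k).take m) := by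
  induction n generalizing F with
  | zero =>
    have := comp_agreeTo F (H := leftDilate G) (H' := leftDilate G') fun i => h.mul_X i
    refine ⟨fun u hu => this u (by omega), fun W hW => ?_⟩
    rw [this W (by omega), sub_self, range_zero, sum_empty]
  | succ n ih =>
    have hFj : ∀ j, ∀ u : List (Fin d), u.length < n → rightD j F u = 0 := fun j u hu =>
      hF _ (by simp; omega)
    have hd : ∀ j : Fin d, comp (rightD j F) (leftDilate G) * G -
        comp (rightD j F) (leftDilate G') * G' =
        (comp (rightD j F) (leftDilate G) - comp (rightD j F) (leftDilate G')) * G +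
          comp (rightD j F) (leftDilate G') * (G - G') := fun j => by noncomm_ring
    have h1 : ∀ (j : Fin d) (u : List (Fin d)), u.length ≤ n + m →
        ((comp (rightD j F) (leftDilate G) - comp (rightD j F) (leftDilate G')) * G) u =
          comp (rightD j F) (leftDilate G) u - comp (rightD j F) (leftDilate G') u := by
      intro j u hu
      rw [mul_apply, sum_range_succ, sum_eq_zero]
      · simp [hG, sub_apply]
      · intro k hk
        rw [sub_apply, (ih (rightD j F) (hFj j)).1 _ (by simp at hk ⊢; omega), sub_self, zero_mul]
    have h2 : ∀ (j : Fin d) (u : List (Fin d)), u.length ≤ n + m →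
        (comp (rightD j F) (leftDilate G') * (G - G')) u =
          if u.length = n + m then F (u.take n ++ [j]) * (G - G') (u.drop n) else 0 := by
      intro j u hu
      have hz : ∀ k ∈ range (u.length + 1), (u.length = n + m → k ≠ n) →
          comp (rightD j F) (leftDilate G') (u.take k) * (G - G') (u.drop k) = 0 := by
        intro k hk hkn
        simp only [mem_range] at hk
        rcases Nat.lt_or_ge k n with hlt | hge
        · rw [comp_apply_of_vanish hG' (hFj j) _ (by simp; omega), hFj j _ (by simp; omega),
            zero_mul]
        · rw [sub_apply, h _ (by simp; omega), sub_self, mul_zero]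
      rw [mul_apply]
      split_ifs with hl
      · rw [sum_eq_single n (fun k hk hkn => hz k hk fun _ => hkn) (by simp; omega),
          comp_apply_of_vanish hG' (hFj j) _ (by simp)]
        rfl
      · exact sum_eq_zero fun k hk => hz k hk fun h => absurd h hl
    have h3 : ∀ (j : Fin d) (u : List (Fin d)), u.length ≤ n + m →
        comp F (leftDilate G) (u ++ [j]) - comp F (leftDilate G') (u ++ [j]) =
          (comp (rightD j F) (leftDilate G) u - comp (rightD j F) (leftDilate G') u) +
            if u.length = n + m then F (u.take n ++ [j]) * (G - G') (u.drop n) else 0 := by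
      intro j u hu
      rw [comp_leftDilate_concat, comp_leftDilate_concat, ← sub_apply, hd, add_apply, h1 j u hu,
        h2 j u hu]
    refine ⟨fun W hW => ?_, fun W hW => ?_⟩
    · rcases W.eq_nil_or_concat with rfl | ⟨u, j, rfl⟩
      · rw [comp_nil, comp_nil]
      · simp only [List.concat_eq_append, List.length_append, List.length_singleton] at hW ⊢
        refine sub_eq_zero.1 ?_
        rw [h3 j u (by omega), (ih (rightD j F) (hFj j)).1 u (by omega), if_neg (by omega)]
        simp
    · rcases W.eq_nil_or_concat with rfl | ⟨u, j, rfl⟩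
      · simp at hW; omega
      · simp only [List.concat_eq_append, List.length_append, List.length_singleton] at hW ⊢
        have hu : u.length = n + m := by omega
        rw [h3 j u hu.le, if_pos hu, (ih (rightD j F) (hFj j)).2 u hu, sum_range_succ]
        congr 1
        · refine sum_congr rfl fun k hk => ?_
          simp only [mem_range] at hk
          rw [List.take_append_of_le_length (by omega), List.drop_append_of_le_length (by omega),
            List.drop_append_of_le_length (by omega),
            List.take_append_of_le_length (by simp; omega), rightD_apply, List.append_assoc]
        · have e : u.drop (n + m) = [] := List.drop_of_length_le hu.le
          rw [List.take_append_of_le_length (by omega), List.drop_append_of_le_length (by omega),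
            List.drop_append_of_le_length (by omega),
            List.take_append_of_le_length (by simp; omega), e, List.nil_append,
            List.take_of_length_le (l := u.drop n) (by simp; omega)]

theorem condSeries_injective_right {R M M' : NCSeries d} (hR : R [] = 0) (hM : M [] = 0)
    (hM' : M' [] = 0) (hR2 : ∃ u, 2 ≤ u.length ∧ R u ≠ 0)
    (h : condSeries R M = condSeries R M') : M = M' := by
  classical
  by_contra hne
  have hex : ∃ m, ∃ u : List (Fin d), u.length = m ∧ M u ≠ M' u := by
    by_contra hcon
    push Not at hcon
    exact hne (NCSeries.ext fun u => hcon _ u rfl)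
  have hex2 : ∃ n, ∃ u : List (Fin d), u.length = n ∧ 2 ≤ n ∧ R u ≠ 0 := by
    obtain ⟨u, h1, h2⟩ := hR2
    exact ⟨_, u, rfl, h1, h2⟩
  obtain ⟨v, hvl, hv⟩ := Nat.find_spec hex
  obtain ⟨u, hul, hn2, hu⟩ := Nat.find_spec hex2
  set m := Nat.find hex with hm
  set n := Nat.find hex2 with hn
  have hag : AgreeTo m (1 + M) (1 + M') := by
    intro w hw
    have := Nat.find_min hex hw
    push Not at this
    rw [add_apply, add_apply, this w rfl]
  have hm1 : 1 ≤ m := by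
    rcases Nat.eq_zero_or_pos m with h0 | h0
    · rw [h0, List.length_eq_zero_iff] at hvl
      rw [hvl, hM, hM'] at hv
      exact absurd rfl hv
    · exact h0
  obtain ⟨i, u', rfl⟩ := List.exists_cons_of_length_pos (l := u) (by omega)
  set F : NCSeries d := leftD i R - R [i] • 1 with hFdef
  have hF : ∀ w, w.length < n - 1 → F w = 0 := by
    intro w hw
    rw [hFdef, sub_apply, smul_apply, leftD_apply, one_apply]
    by_cases hw0 : w = []
    · simp [hw0]
    · have := List.length_pos_of_ne_nil hw0
      have hlt : (i :: w).length < n := by rw [List.length_cons]; omega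
      have h1 := Nat.find_min hex2 hlt
      push Not at h1
      rw [h1 _ rfl (by simp; omega)]
      simp [hw0]
  have hFu : F u' ≠ 0 := by
    have : u' ≠ [] := by rintro rfl; simp at hul; omega
    rw [hFdef, sub_apply, smul_apply, leftD_apply, one_apply, if_neg this]
    simpa using hu
  obtain ⟨W, hWl, hW⟩ := exists_insertion_ne_zero F ((1 + M) - (1 + M')) (n := n - 1) (m := m)
    (by omega) ⟨u', by simp at hul; omega, hFu⟩
    ⟨v, hvl, by
      rw [sub_apply, add_apply, add_apply, add_sub_add_left_eq_sub]; exact sub_ne_zero.2 hv⟩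
  rw [← (comp_sub_comp (one_add_nil hM) (one_add_nil hM') hm1 hag (n - 1) F hF).2 W hWl] at hW
  apply hW
  have := congrFun h (i :: W)
  rw [condSeries_cons R M hR hM, condSeries_cons R M' hR hM'] at this
  rw [hFdef, comp_sub, comp_sub, comp_smul, comp_smul, comp_one _ (leftDilate_nil _),
    comp_one _ (leftDilate_nil _), sub_apply, sub_apply, this, sub_self]

end NCSeries

namespace Functional

open NCSeries

variable {d : ℕ}

theorem Phi_injective_right {ρ ψ ψ' : Functional d} (hρ : ∀ a : Fin d → ℝ, ρ ≠ delta a)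
    (h : Phi ρ ψ = Phi ρ ψ') : ψ = ψ' := by
  refine ext_M (condSeries_injective_right ρ.R_nil ψ.M_nil ψ'.M_nil ?_
    (by rw [← eta_Phi_eq, h, eta_Phi_eq]))
  by_contra hcon
  push Not at hcon
  exact hρ _ (eq_delta_of_R hcon)

theorem Phi_eq_left_iff (ρ σ : Functional d) :
    Phi σ ρ = σ ↔ σ = ρ ∨ ∃ a : Fin d → ℝ, σ = delta a := by
  constructor
  · intro h
    by_cases hσ : ∃ a : Fin d → ℝ, σ = delta a
    · exact Or.inr hσ
    · push Not at hσ
      exact Or.inl (Phi_injective_right hσ ((Phi_self σ).trans h.symm))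
  · rintro (rfl | ⟨a, rfl⟩)
    · exact Phi_self σ
    · exact Phi_delta_left a ρ

end Functional

namespace Functional

open NCSeries Kernel
open scoped ComplexOrder

variable {d : ℕ}

/-! ### Point masses and free translations -/

theorem mul_linSeries (a : Fin d → ℝ) :
    (1 + (delta a).M) * linSeries a = (1 + (delta a).M) - 1 := by
  rw [← eta_delta, eta, mul_etaOf _ (M_nil _), add_sub_cancel_left]

theorem linSeries_neg (a : Fin d → ℝ) : linSeries (-a) = -linSeries a := by
  ext u
  simp [linSeries, NCSeries.sum_apply, NCSeries.smul_apply, NCSeries.neg_apply,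
    -Complex.coe_smul]

theorem inv_mul_rev {F G : NCSeries d} (hF : F [] = 1) (hG : G [] = 1) :
    NCSeries.inv (F * G) = NCSeries.inv G * NCSeries.inv F := by
  refine inv_eq_of_mul_eq_one (by rw [mul_nil, hF, hG, one_mul]) ?_
  rw [mul_assoc, ← mul_assoc G, NCSeries.mul_inv G hG, one_mul, NCSeries.mul_inv F hF]

theorem eta_freeConv_delta (σ : Functional d) (a : Fin d → ℝ) :
    (freeConv σ (delta a)).eta + linSeries (-a) = condSeries σ.eta (delta a).M := by
  set K := 1 + (delta a).M with hK
  have hK0 : K [] = 1 := one_add_nil (M_nil _)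
  set N := comp (1 + σ.M) (leftDilate K) with hN
  have hN0 : N [] = 1 := by rw [hN, comp_nil, one_add_nil σ.M_nil]
  have hNM : comp σ.M (leftDilate K) = N - 1 := by
    rw [hN, comp_add, comp_one _ (leftDilate_nil K), add_sub_cancel_left]
  have hM : (freeConv σ (delta a)).M = N * K - 1 := by
    have h := momentOfFree_unique (N * K - 1) (freeConv σ (delta a)).R ?_
    · rw [h]; exact momentOfFree_unique _ _ (R_spec _)
    · rw [add_sub_cancel, R_freeConv, R_delta, comp_add, comp_linSeries, hN,
        ← comp_leftDilate_comp, R_spec, ← hN, hNM, mul_assoc, hK, mul_linSeries, ← hK]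
      noncomm_ring
  rw [eta, etaOf, hM, add_sub_cancel, inv_mul_rev hN0 hK0, linSeries_neg, condSeries, ← hK, eta,
    etaOf, comp_sub, comp_one _ (leftDilate_nil K),
    comp_inv _ _ (one_add_nil σ.M_nil) (leftDilate_nil K), ← hN, mul_sub, mul_one, hK,
    inv_one_add_M_delta]
  noncomm_ring

theorem eta_B (a : Fin d → ℝ) (t : ℝ) (ρ : Functional d) : (B a t ρ).eta =
    ((1 / (1 + t) : ℝ) : ℂ) • condSeries (ρ.freePow (1 + t)).eta (delta a).M := by
  rw [B, eta_boolPow, eta_boolConv, eta_delta (-a), eta_freeConv_delta]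

theorem condSeries_zero_right (R : NCSeries d) : condSeries R 0 = R := by
  rw [condSeries, add_zero, comp_id, inv_eq_of_mul_eq_one (G := 1) (by simp [one_apply]) (one_mul 1),
    one_mul]

/-! ### The Boolean-to-free bijection -/

theorem eta_BP (σ : Functional d) : (BP σ).eta = ((1 / 2 : ℝ) : ℂ) • (σ.freePow 2).eta := by
  rw [BP, eta_B, delta_zero_M, condSeries_zero_right]
  norm_num

theorem R_BP (σ : Functional d) : (BP σ).R = σ.eta := by
  set M₂ := (σ.freePow 2).M with hM₂
  set K := 1 + (BP σ).M with hK
  set G : NCSeries d := 1 + (1 / 2 : ℂ) • M₂ with hG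
  have hK0 : K [] = 1 := one_add_nil (M_nil _)
  have hM0 : M₂ [] = 0 := M_nil _
  have hG0 : G [] = 1 := by rw [hG]; exact one_add_nil (by rw [NCSeries.smul_apply, hM0, mul_zero])
  have hinv : NCSeries.inv K = 1 - (1 / 2 : ℂ) • etaOf M₂ := by
    have := eta_BP σ
    rw [hK, inv_one_add]
    rw [eta] at this
    rw [this, eta, ← hM₂]
    norm_num
  have hGK : G * K = 1 + M₂ := by
    have h1 : G = (1 + M₂) * NCSeries.inv K := by
      rw [hinv, mul_sub, mul_one, NCSeries.mul_smul', mul_etaOf M₂ hM0, hG]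
      module
    rw [h1, mul_assoc, NCSeries.inv_mul K hK0, mul_one]
  have hcontr : Contracting fun N : NCSeries d => 1 + comp σ.R (leftDilate (N * K)) := by
    intro n F F' h u hu
    change (1 + comp σ.R (leftDilate (F * K))) u = (1 + comp σ.R (leftDilate (F' * K))) u
    have hFK : AgreeTo n (F * K) (F' * K) := h.mul fun _ _ => rfl
    rw [NCSeries.add_apply, NCSeries.add_apply, comp_agreeTo σ.R (H := leftDilate (F * K))
      (H' := leftDilate (F' * K)) (fun i => hFK.mul_X i) u hu]
  set N := comp (1 + σ.M) (leftDilate K) with hN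
  have hNG : N = G := by
    refine hcontr.unique ?_ ?_
    · rw [hN, ← comp_leftDilate_comp, R_spec, comp_add, comp_one _ (leftDilate_nil K)]
    · have h2 := R_spec (σ.freePow 2)
      rw [R_freePow, comp_smul, ← hM₂] at h2
      have h3 : (1 / 2 : ℂ) • M₂ = comp σ.R (leftDilate (1 + M₂)) := by
        conv_lhs => rw [← h2]
        rw [smul_smul]
        norm_num
      rw [hGK, hG, h3]
  have hcomp : comp σ.eta (leftDilate K) = 1 - NCSeries.inv G := by
    rw [eta, etaOf, comp_sub, comp_one _ (leftDilate_nil K),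
      comp_inv _ _ (one_add_nil σ.M_nil) (leftDilate_nil K), ← hN, hNG]
  refine (freeOf_unique _ _ (M_nil _) ?_).symm
  rw [← hK, hcomp]
  have hl : G * (1 - NCSeries.inv G) = G * (BP σ).M := by
    have e : (BP σ).M = K - 1 := by rw [hK, add_sub_cancel_left]
    rw [e, mul_sub, mul_sub, mul_one, NCSeries.mul_inv G hG0, hGK, hG]
    module
  have := congrArg (fun F => NCSeries.inv G * F) hl
  simpa only [← mul_assoc, NCSeries.inv_mul G hG0, one_mul] using this

theorem BP_bijective : Function.Bijective (BP : Functional d → Functional d) := by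
  refine ⟨fun σ σ' h => ext_eta ?_, fun ρ => ⟨ofEta ρ.R ρ.R_nil ρ.adj_R, ext_R ?_⟩⟩
  · rw [← R_BP, h, R_BP]
  · rw [R_BP, eta_ofEta]

theorem eta_invFun_BP (ρ : Functional d) : (Function.invFun BP ρ).eta = ρ.R := by
  rw [← R_BP, Function.invFun_eq (BP_bijective.2 ρ)]

theorem Phi_delta_zero (ρ : Functional d) : Phi ρ (delta 0) = Function.invFun BP ρ := by
  apply ext_eta
  rw [eta_Phi_eq, delta_zero_M, condSeries_zero_right, eta_invFun_BP]

theorem Phi_delta_eq_B (ρ : Functional d) (a : Fin d → ℝ) :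
    Phi ρ (delta a) = B a 0 (Function.invFun BP ρ) := by
  have h1 : ∀ σ : Functional d, σ.freePow 1 = σ := fun σ => ext_R (by rw [R_freePow]; simp)
  apply ext_eta
  rw [eta_Phi_eq, eta_B, add_zero, h1, eta_invFun_BP]
  simp

theorem tendsTo_eta_freePow_div (ρ : Functional d) :
    TendsTo (fun s : ℝ => ((s⁻¹ : ℝ) : ℂ) • (ρ.freePow s).eta) (nhdsWithin 0 {0}ᶜ) ρ.R := by
  have h1 := tendsTo_momentOfFree_div ρ.R
  have h2 : TendsTo (fun s : ℝ => 1 + momentOfFree ((s : ℂ) • ρ.R)) (nhdsWithin 0 {0}ᶜ) 1 := by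
    have := (TendsTo.const (l := nhds 0) 1).add (tendsTo_momentOfFree ρ.R)
    rw [add_zero] at this
    exact fun u => (this u).mono_left nhdsWithin_le_nhds
  have h3 := h1.mul h2.inv
  rw [inv_eq_of_mul_eq_one (F := 1) (G := 1) (by simp [one_apply]) (one_mul 1), mul_one] at h3
  convert h3 using 2 with s
  rw [NCSeries.smul_mul', eta, M_freePow]
  congr 1
  have h0 : momentOfFree ((s : ℂ) • ρ.R) [] = 0 := by rw [← M_freePow]; exact M_nil _
  conv_rhs => rw [← etaOf_mul _ h0]
  rw [mul_assoc]
  conv_rhs => rw [etaOf_mul _ h0, NCSeries.mul_inv _ (one_add_nil h0), mul_one]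

theorem tendsto_apply {ι : Type*} {l : Filter ι} {φ : ι → Functional d} {ψ : Functional d}
    (h : TendsTo (fun t => (φ t).eta) l ψ.eta) (p : NCPoly d) :
    Filter.Tendsto (fun t => φ t p) l (nhds (ψ p)) := by
  have hM : TendsTo (fun t => 1 + (φ t).M) l (1 + ψ.M) := by
    simp only [M_eq_momentOfEta, momentOfEta]
    exact (TendsTo.const 1).add ((((TendsTo.const 1).sub h).inv).sub (TendsTo.const 1))
  induction p using MonoidAlgebra.induction_linear with
  | zero => simpa only [map_zero] using tendsto_const_nhds
  | add p q hp hq => simpa only [map_add] using hp.add hq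
  | single u c =>
    have e : (MonoidAlgebra.single u c : NCPoly d) = c • NCPoly.mon u.toList := by
      simp [NCPoly.mon]
    simp only [e, map_smul, apply_mon, smul_eq_mul]
    exact (hM _).const_mul c

theorem tendsto_B (ρ : Functional d) (a : Fin d → ℝ) (p : NCPoly d) :
    Filter.Tendsto (fun t : ℝ => B a t ρ p) (nhdsWithin (-1) {-1}ᶜ)
      (nhds (Phi ρ (delta a) p)) := by
  refine tendsto_apply ?_ p
  have hs : Filter.Tendsto (fun t : ℝ => 1 + t) (nhdsWithin (-1) {-1}ᶜ) (nhdsWithin 0 {0}ᶜ) := by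
    refine tendsto_nhdsWithin_iff.2 ⟨?_, ?_⟩
    · have : Filter.Tendsto (fun t : ℝ => 1 + t) (nhds (-1)) (nhds (1 + -1)) :=
        (continuous_const.add continuous_id).tendsto _
      rw [add_neg_cancel] at this
      exact this.mono_left nhdsWithin_le_nhds
    · filter_upwards [self_mem_nhdsWithin] with t ht h
      exact ht (by simp only [Set.mem_singleton_iff] at h ⊢; linarith)
  have h1 := (TendsTo.const (inv (1 + (delta a).M))).mul
    ((tendsTo_eta_freePow_div ρ).comp fun i => TendsTo.const (leftDilate (1 + (delta a).M) i))
  intro u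
  have h2 := (h1 u).comp hs
  rw [eta_Phi_eq]
  refine h2.congr fun t => ?_
  change (inv (1 + (delta a).M) * comp ((((1 + t)⁻¹ : ℝ) : ℂ) • (ρ.freePow (1 + t)).eta)
    (leftDilate (1 + (delta a).M)) : NCSeries d) u = (B a t ρ).eta u
  rw [eta_B, comp_smul, NCSeries.mul_smul', one_div]
  rfl

/-! ### Test states -/

/-- The Boolean cumulant series `∑ i, w_i (1 - ∑ j, a i j w_j)⁻¹ w_i`. -/
noncomputable def bracketSeries (a : Fin d → Fin d → ℝ) : NCSeries d :=
  ∑ i, X i * (1 + (delta (a i)).M) * X i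

theorem bracketSeries_nil (a : Fin d → Fin d → ℝ) : bracketSeries a [] = 0 := by
  rw [bracketSeries, NCSeries.sum_apply]
  exact sum_eq_zero fun i _ => by rw [mul_nil, X_nil, mul_zero]

theorem adj_bracketSeries (a : Fin d → Fin d → ℝ) :
    NCSeries.adj (bracketSeries a) = bracketSeries a := by
  rw [bracketSeries, NCSeries.adj_sum]
  refine sum_congr rfl fun i _ => ?_
  rw [NCSeries.adj_mul, NCSeries.adj_mul, NCSeries.adj_X, NCSeries.adj_add, NCSeries.adj_one,
    adj_M, mul_assoc]

theorem bracketSeries_singleton (a : Fin d → Fin d → ℝ) (i : Fin d) :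
    bracketSeries a [i] = 0 := by
  rw [bracketSeries, NCSeries.sum_apply]
  refine sum_eq_zero fun j _ => ?_
  rw [mul_assoc, X_mul_cons, mul_nil, X_nil, mul_zero, ite_self]

theorem bracketSeries_apply (a : Fin d → Fin d → ℝ) (i j : Fin d) (u : List (Fin d)) :
    bracketSeries a (i :: (u ++ [j])) = if i = j then (((u.map (a i)).prod : ℝ) : ℂ) else 0 := by
  rw [bracketSeries, NCSeries.sum_apply, sum_eq_single i]
  · rw [mul_assoc, X_mul_cons, if_pos rfl, mul_X_concat, one_add_M_delta_apply]
    simp only [eq_comm]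
  · intro k _ hk
    rw [mul_assoc, X_mul_cons, if_neg hk.symm]
  · simp

theorem condPos_bracketSeries (a : Fin d → Fin d → ℝ) : CondPos (bracketSeries a) := by
  have := posSemidef_gram fun (b : List (Fin d) × Fin d) (k : Fin d) =>
    if b.2 = k then (((b.1.map (a k)).prod : ℝ) : ℂ) else 0
  rw [CondPos]
  convert this using 1
  ext ⟨s, i⟩ ⟨t, j⟩
  rw [condHankel_apply, bracketSeries_apply, Matrix.of_apply]
  rw [sum_eq_single i]
  · by_cases h : i = j
    · subst h; simp [List.prod_reverse]
    · simp [h, Ne.symm h]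
  · intro k _ hk; simp [hk.symm]
  · simp

/-- A state with mean zero and identity covariance. -/
noncomputable def bracketState (a : Fin d → Fin d → ℝ) : Functional d :=
  ofEta (bracketSeries a) (bracketSeries_nil a) (adj_bracketSeries a)

theorem eta_bracketState (a : Fin d → Fin d → ℝ) : (bracketState a).eta = bracketSeries a :=
  eta_ofEta _ _ _

theorem isState_bracketState (a : Fin d → Fin d → ℝ) : (bracketState a).IsState := by
  rw [isState_iff_condPos_eta, eta_bracketState]
  exact condPos_bracketSeries a

theorem bracketSeries_pair (a : Fin d → Fin d → ℝ) (i j : Fin d) :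
    bracketSeries a [i, j] = if i = j then 1 else 0 := by
  simpa using bracketSeries_apply a i j []

theorem bracketSeries_triple (a : Fin d → Fin d → ℝ) (i k j : Fin d) :
    bracketSeries a [i, k, j] = if i = j then (a i k : ℂ) else 0 := by
  simpa using bracketSeries_apply a i j [k]

theorem mean_bracketState (a : Fin d → Fin d → ℝ) : (bracketState a).mean = 0 := by
  funext i
  rw [mean_apply, eta_bracketState, bracketSeries_singleton]
  rfl

theorem cov_bracketState (a : Fin d → Fin d → ℝ) : (bracketState a).cov = 1 := by
  ext i j
  rw [cov_apply, eta_bracketState, bracketSeries_pair, Matrix.one_apply]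

theorem R_pair_of_cov {ρ : Functional d} (h : ρ.cov = 1) (i j : Fin d) :
    ρ.R [i, j] = if i = j then 1 else 0 := by
  rw [← eta_pair, ← cov_apply, h, Matrix.one_apply]

/-- If `Φ[ρ, ψ]` is the symmetric Bernoulli state, the third and fourth free cumulants of `ρ` and
the variance of `ψ` are degenerate. -/
theorem degenerate_of_Phi_eq_bracketState {ρ ψ : Functional d} (hρ : ρ.R.CondPos)
    (hψ : ψ.IsState) (h : Phi ρ ψ = bracketState 0) (i : Fin d) :
    ρ.R [i, i, i, i] = ρ.R [i, i, i] * ρ.R [i, i, i] ∧ ψ.M [i, i] = ψ.M [i] * ψ.M [i] := by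
  have he : condSeries ρ.R ψ.M = bracketSeries 0 := by rw [← eta_Phi_eq, h, eta_bracketState]
  have e2 : ρ.R [i, i] = 1 := by
    rw [← condSeries_two ρ.R ψ.M ρ.R_nil ψ.M_nil, he, bracketSeries_pair, if_pos rfl]
  have e3 : ρ.R [i, i, i] + ψ.M [i] = 0 := by
    have := condSeries_three ρ.R ψ.M ρ.R_nil ψ.M_nil i i i
    rw [he, bracketSeries_triple, e2] at this
    simpa using this.symm
  have e4 : ρ.R [i, i, i, i] + 2 * (ρ.R [i, i, i] * ψ.M [i]) + ψ.M [i, i] = 0 := by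
    have := condSeries_four ρ.R ψ.M ρ.R_nil ψ.M_nil i i i i
    have h4 := bracketSeries_apply (0 : Fin d → Fin d → ℝ) i i [i, i]
    simp only [List.cons_append, List.nil_append] at h4
    rw [he, h4, e2] at this
    simp at this
    linear_combination this.symm
  have hR3 : conj (ρ.R [i, i, i]) = ρ.R [i, i, i] := by
    simpa [NCSeries.adj_apply] using congrFun ρ.adj_R [i, i, i]
  have hM1 : conj (ψ.M [i]) = ψ.M [i] := by
    simpa [NCSeries.adj_apply] using congrFun ψ.adj_M [i]
  have p1 : 0 ≤ ρ.R [i, i, i, i] - ρ.R [i, i, i] * ρ.R [i, i, i] := by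
    have := form_nonneg hρ (Finsupp.single ([i], i) 1 - ρ.R [i, i, i] • Finsupp.single ([], i) 1)
    simp only [map_sub, LinearMap.sub_apply, map_smul, LinearMap.map_smulₛₗ, LinearMap.smul_apply,
      form_single, condHankel_apply, smul_eq_mul, hR3] at this
    simp [e2] at this
    simpa using this
  have p2 : 0 ≤ ψ.M [i, i] - ψ.M [i] * ψ.M [i] := by
    have := form_nonneg ((isState_iff ψ).1 hψ)
      (Finsupp.single [i] 1 - ψ.M [i] • Finsupp.single [] 1)
    simp only [map_sub, LinearMap.sub_apply, map_smul, LinearMap.map_smulₛₗ, LinearMap.smul_apply,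
      form_single, hankel_apply, smul_eq_mul, hM1] at this
    simp [NCSeries.add_apply, NCSeries.one_apply, M_nil] at this
    simpa using this
  have e5 : ρ.R [i, i, i, i] - ρ.R [i, i, i] * ρ.R [i, i, i] =
      -(ψ.M [i, i] - ψ.M [i] * ψ.M [i]) := by
    have : ρ.R [i, i, i] = -ψ.M [i] := by linear_combination e3
    rw [this] at e4 ⊢
    linear_combination e4
  rw [e5] at p1
  have hz := le_antisymm (neg_nonneg.1 p1) p2
  exact ⟨sub_eq_zero.1 (by rw [e5, hz, neg_zero]), sub_eq_zero.1 hz⟩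

theorem eq_delta_of_variance_zero {ψ : Functional d} (hψ : ψ.IsState)
    (h : ∀ i, ψ.M [i, i] = ψ.M [i] * ψ.M [i]) : ψ = delta fun i => (ψ.M [i]).re := by
  have hK := (isState_iff ψ).1 hψ
  have hM1 : ∀ i, conj (ψ.M [i]) = ψ.M [i] := fun i => by
    simpa [NCSeries.adj_apply] using congrFun ψ.adj_M [i]
  have hstep : ∀ (w : List (Fin d)) (i : Fin d), (1 + ψ.M) (w ++ [i]) = (1 + ψ.M) w * ψ.M [i] := by
    intro w i
    have h0 : form (hankel (1 + ψ.M)) (Finsupp.single [i] 1 - ψ.M [i] • Finsupp.single [] 1)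
        (Finsupp.single [i] 1 - ψ.M [i] • Finsupp.single [] 1) = 0 := by
      simp only [map_sub, LinearMap.sub_apply, map_smul, LinearMap.map_smulₛₗ,
        LinearMap.smul_apply, form_single, hankel_apply, smul_eq_mul, hM1]
      simp [NCSeries.add_apply, NCSeries.one_apply, M_nil, h]
    have := form_eq_zero_of_self hK h0 (Finsupp.single w.reverse 1)
    simp only [map_sub, map_smul, form_single, hankel_apply, smul_eq_mul, List.reverse_reverse,
      List.append_nil] at this
    simp at this
    linear_combination this
  apply ext_M
  rw [← add_right_inj (1 : NCSeries d)]
  ext w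
  rw [one_add_M_delta_apply]
  induction w using List.reverseRecOn with
  | nil => simp [NCSeries.add_apply, NCSeries.one_apply, M_nil]
  | append_singleton w i ih =>
    rw [hstep, ih]
    simp [Complex.conj_eq_iff_re.1 (hM1 i)]

theorem exists_isFreelyInfDiv_Phi_delta {φ : Functional d} (hφ : φ.IsState) (a : Fin d → ℝ) :
    ∃ ρ : Functional d, ρ.IsFreelyInfDiv ∧ Phi ρ (delta a) = φ := by
  let σ : Functional d := ofR φ.eta φ.eta_nil φ.adj_eta
  have hσR : σ.R = φ.eta := R_ofR _ _ _
  have hσ : σ.R.CondPos := by rw [hσR]; exact (isState_iff_condPos_eta φ).1 hφ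
  let τ : Functional d := Phi σ (delta (-a))
  have hτ : τ.eta.CondPos := (isState_iff_condPos_eta τ).1 (isState_Phi hσ (isState_delta _))
  let ρ : Functional d := ofR τ.eta τ.eta_nil τ.adj_eta
  have hρR : ρ.R = τ.eta := R_ofR _ _ _
  refine ⟨ρ, (isFreelyInfDiv_iff ρ).2 (by rwa [hρR]), ext_eta ?_⟩
  rw [eta_Phi_eq, hρR, eta_Phi_eq, hσR]
  set K := 1 + (delta a).M with hK
  have hK0 : K [] = 1 := one_add_nil (M_nil _)
  have h1 : comp (NCSeries.inv (1 + (delta (-a)).M)) (leftDilate K) = K := by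
    rw [inv_one_add_M_delta, linSeries_neg, sub_neg_eq_add, comp_add, comp_linSeries,
      comp_one _ (leftDilate_nil K), hK, mul_linSeries, add_sub_cancel]
  have h2 : comp (1 + (delta (-a)).M) (leftDilate K) * K = 1 := by
    conv_lhs => arg 2; rw [← h1]
    rw [← comp_mul _ _ _ (leftDilate_nil K), NCSeries.mul_inv _ (one_add_nil (M_nil _)),
      comp_one _ (leftDilate_nil K)]
  rw [condSeries, ← hK, condSeries, comp_mul _ _ _ (leftDilate_nil K), h1, comp_leftDilate_comp,
    h2, comp_id, ← mul_assoc, NCSeries.inv_mul K hK0, one_mul]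

theorem Phi_onto_iff {ψ : Functional d} (hψ : ψ.IsState) :
    {φ | ∃ ρ : Functional d, ρ.IsFreelyInfDiv ∧ Phi ρ ψ = φ} = {φ : Functional d | φ.IsState} ↔
      ∃ a : Fin d → ℝ, ψ = delta a := by
  constructor
  · intro h
    have hmem : bracketState 0 ∈ {φ : Functional d | φ.IsState} := isState_bracketState 0
    rw [← h] at hmem
    obtain ⟨ρ, hρ, he⟩ := hmem
    exact ⟨_, eq_delta_of_variance_zero hψ fun i =>
      (degenerate_of_Phi_eq_bracketState hρ.condPos hψ he i).2⟩
  · rintro ⟨a, rfl⟩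
    ext φ
    constructor
    · rintro ⟨ρ, hρ, rfl⟩
      exact isState_Phi hρ.condPos hψ
    · exact fun hφ => exists_isFreelyInfDiv_Phi_delta hφ a

theorem Phi_image_ne {ρ : Functional d} (hd : 2 ≤ d) (hmean : ρ.mean = 0) (hcov : ρ.cov = 1) :
    {φ | ∃ ψ : Functional d, ψ.IsState ∧ Phi ρ ψ = φ} ≠
      {φ : Functional d | φ.IsState ∧ φ.mean = ρ.mean ∧ φ.cov = ρ.cov} := by
  intro h
  let i : Fin d := ⟨0, by omega⟩
  let j : Fin d := ⟨1, by omega⟩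
  have hij : j ≠ i := by simp [i, j]
  have key : ∀ a : Fin d → Fin d → ℝ, (a i i : ℂ) - a j i = ρ.R [i, i, i] - ρ.R [j, i, j] := by
    intro a
    have hmem : bracketState a ∈
        {φ : Functional d | φ.IsState ∧ φ.mean = ρ.mean ∧ φ.cov = ρ.cov} :=
      ⟨isState_bracketState a, by rw [mean_bracketState, hmean], by rw [cov_bracketState, hcov]⟩
    rw [← h] at hmem
    obtain ⟨ψ, -, he⟩ := hmem
    have he : condSeries ρ.R ψ.M = bracketSeries a := by rw [← eta_Phi_eq, he, eta_bracketState]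
    have h1 := condSeries_three ρ.R ψ.M ρ.R_nil ψ.M_nil i i i
    have h2 := condSeries_three ρ.R ψ.M ρ.R_nil ψ.M_nil j i j
    rw [he, bracketSeries_triple, R_pair_of_cov hcov, if_pos rfl, if_pos rfl] at h1 h2
    linear_combination h1 - h2
  have h0 := key 0
  have h1 := key fun k _ => if k = i then 1 else 0
  rw [← h0] at h1
  simp [hij] at h1

end Functional

namespace Functional

open NCSeries Kernel
open scoped ComplexOrder

/-! ### Jacobi parameters and continued fractions -/

theorem jacobiOp_tail (β γ : ℕ → ℝ) (f : ℕ → ℝ) :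
    (fun n => jacobiOp β γ f (n + 1)) =
      jacobiOp (fun n => β (n + 1)) (fun n => γ (n + 1)) (fun n => f (n + 1)) +
        f 0 • Pi.single 0 1 := by
  funext n
  cases n with
  | zero => simp [jacobiOp]; ring
  | succ n => simp [jacobiOp]

theorem jacobiOp_pow_tail (β γ : ℕ → ℝ) (n : ℕ) :
    (fun k => (jacobiOp β γ ^ n) (Pi.single 0 1) (k + 1)) =
      ∑ j ∈ range n, (jacobiOp β γ ^ (n - 1 - j)) (Pi.single 0 1) 0 •
        (jacobiOp (fun n => β (n + 1)) (fun n => γ (n + 1)) ^ j) (Pi.single 0 1) := by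
  induction n with
  | zero => funext k; simp
  | succ n ih =>
    simp only [pow_succ' (jacobiOp β γ) n, Module.End.mul_apply]
    rw [jacobiOp_tail, ih, map_sum, sum_range_succ']
    congr 1
    refine sum_congr rfl fun j hj => ?_
    rw [map_smul, pow_succ', Module.End.mul_apply, show n + 1 - 1 - (j + 1) = n - 1 - j by omega]

theorem jacobiOp_pow_succ_zero (β γ : ℕ → ℝ) (n : ℕ) :
    (jacobiOp β γ ^ (n + 1)) (Pi.single 0 1) 0 =
      β 0 * (jacobiOp β γ ^ n) (Pi.single 0 1) 0 +
        γ 1 * ∑ j ∈ range n,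
          (jacobiOp (fun n => β (n + 1)) (fun n => γ (n + 1)) ^ j) (Pi.single 0 1) 0 *
            (jacobiOp β γ ^ (n - 1 - j)) (Pi.single 0 1) 0 := by
  have h := congrFun (jacobiOp_pow_tail β γ n) 0
  rw [pow_succ', Module.End.mul_apply]
  simp only [zero_add] at h
  have e : ∀ f : ℕ → ℝ, jacobiOp β γ f 0 = β 0 * f 0 + γ 1 * f 1 := fun f => by simp [jacobiOp]
  rw [e, h, Finset.sum_apply]
  simp only [Pi.smul_apply, smul_eq_mul, mul_comm]

theorem one_add_M_ofJacobi (β γ : ℕ → ℝ) (u : List (Fin 1)) :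
    (1 + (ofJacobi β γ).M) u = ((jacobiOp β γ ^ u.length) (Pi.single 0 1) 0 : ℝ) := by
  rw [ofJacobi, M_ofM, NCSeries.add_apply, NCSeries.one_apply, jacobiSeries]
  by_cases h : u = [] <;> simp [h]

theorem eta_ofJacobi (β γ : ℕ → ℝ) : (ofJacobi β γ).eta =
    (β 0 : ℂ) • X 0 +
      (γ 1 : ℂ) • (X 0 * (1 + (ofJacobi (fun n => β (n + 1)) fun n => γ (n + 1)).M) * X 0) := by
  set G := 1 + (ofJacobi β γ).M with hG
  set G' := 1 + (ofJacobi (fun n => β (n + 1)) fun n => γ (n + 1)).M with hG'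
  set E := (β 0 : ℂ) • X 0 + (γ 1 : ℂ) • (X 0 * G' * X 0) with hE
  have hmul : E * G = (ofJacobi β γ).M := by
    rw [← add_right_inj (1 : NCSeries 1), ← hG]
    ext u
    cases u with
    | nil =>
      rw [hE, hG]
      simp [NCSeries.add_apply, mul_nil, NCSeries.smul_apply, X_nil, M_nil, -Complex.coe_smul]
    | cons i w =>
      obtain rfl : i = 0 := Subsingleton.elim _ _
      have h1 : (G' * (X 0 * G) : NCSeries 1) w =
          ∑ k ∈ range w.length, G' (w.take k) * G (w.drop (k + 1)) := by
        rw [NCSeries.mul_apply, sum_range_succ, List.drop_length, mul_nil, X_nil, zero_mul,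
          mul_zero, add_zero]
        refine sum_congr rfl fun k hk => ?_
        rw [List.drop_eq_getElem_cons (by simpa using hk), X_mul_cons,
          if_pos (Subsingleton.elim _ _)]
      rw [NCSeries.add_apply, hE, add_mul, NCSeries.smul_mul', NCSeries.smul_mul', mul_assoc,
        mul_assoc, NCSeries.add_apply, NCSeries.smul_apply, NCSeries.smul_apply, X_mul_cons,
        X_mul_cons, if_pos rfl, if_pos rfl, h1]
      simp only [hG, hG', one_add_M_ofJacobi, List.length_cons, jacobiOp_pow_succ_zero]
      push_cast
      rw [NCSeries.one_apply, if_neg (by simp), zero_add]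
      congr 2
      refine sum_congr rfl fun k hk => ?_
      simp only [mem_range] at hk
      rw [List.length_take, List.length_drop, min_eq_left hk.le,
        show w.length - (k + 1) = w.length - 1 - k by omega]
  have h2 := congrArg (· * NCSeries.inv G) hmul
  have hG0 : G [] = 1 := one_add_nil (M_nil _)
  simp only [mul_assoc, NCSeries.mul_inv G hG0, mul_one] at h2
  rw [h2, eta, etaOf, ← hG]
  have e : (ofJacobi β γ).M = G - 1 := by rw [hG, add_sub_cancel_left]
  rw [e, sub_mul, NCSeries.mul_inv G hG0, one_mul]

/-! ### Centered free Poisson distributions -/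

theorem eta_PhiOne {d : ℕ} (ψ : Functional d) :
    (PhiOne ψ).eta = ∑ i, X i * (1 + ψ.M) * X i := eta_ofEta _ _ _

/-- The free cumulant series `z² / (1 - b z)`. -/
noncomputable def poissonSeries (b : ℝ) : NCSeries 1 :=
  fun u => if u.length < 2 then 0 else ((b ^ (u.length - 2) : ℝ) : ℂ)

theorem poissonSeries_nil (b : ℝ) : poissonSeries b [] = 0 := by simp [poissonSeries]

theorem adj_poissonSeries (b : ℝ) : NCSeries.adj (poissonSeries b) = poissonSeries b := by
  ext u
  rw [NCSeries.adj_apply, poissonSeries, poissonSeries, List.length_reverse]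
  split_ifs <;> simp

theorem condPos_poissonSeries (b : ℝ) : CondPos (poissonSeries b) := by
  have := posSemidef_gram fun (c : List (Fin 1) × Fin 1) (_ : Unit) => ((b ^ c.1.length : ℝ) : ℂ)
  rw [CondPos]
  convert this using 1
  ext s t
  simp [condHankel_apply, poissonSeries, pow_add]

theorem leftD_poissonSeries (b : ℝ) : leftD 0 (poissonSeries b) =
    X 0 + (b : ℂ) • (X 0 * leftD 0 (poissonSeries b)) := by
  ext u
  rw [NCSeries.add_apply, NCSeries.smul_apply]
  rcases u with _ | ⟨i, _ | ⟨j, u⟩⟩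
  · simp [leftD_apply, poissonSeries, X_nil, mul_nil]
  · obtain rfl : i = 0 := Subsingleton.elim _ _
    rw [X_mul_cons]
    simp [leftD_apply, poissonSeries, X]
  · obtain rfl : i = 0 := Subsingleton.elim _ _
    rw [X_mul_cons]
    simp [leftD_apply, poissonSeries, X, pow_succ']

theorem linSeries_const (b : ℝ) : linSeries (fun _ : Fin 1 => b) = (b : ℂ) • X 0 := by
  simp [linSeries]

theorem Phi_eq_PhiOne_of_R {ρ : Functional 1} {b : ℝ} (hρ : ρ.R = poissonSeries b)
    (ψ : Functional 1) : Phi ρ ψ = PhiOne (boolConv ψ (delta fun _ => b)) := by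
  set G := 1 + ψ.M with hG
  have hG0 : G [] = 1 := one_add_nil ψ.M_nil
  set G' := 1 + (boolConv ψ (delta fun _ => b)).M with hG'
  have hG'0 : G' [] = 1 := one_add_nil (M_nil _)
  set S := comp (leftD 0 (poissonSeries b)) (leftDilate G) with hS
  have hinv : NCSeries.inv G' = NCSeries.inv G - (b : ℂ) • X 0 := by
    have h := eta_boolConv ψ (delta fun _ => b)
    rw [eta_delta, linSeries_const] at h
    rw [hG', inv_one_add, hG, inv_one_add]
    rw [eta] at h
    rw [h, eta, sub_sub]
  have hrec : S = G * X 0 + (b : ℂ) • (G * X 0 * S) := by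
    conv_lhs => rw [hS, leftD_poissonSeries]
    rw [comp_add, comp_smul, comp_mul _ _ _ (leftDilate_nil G), comp_X _ _ (leftDilate_nil G)]
    rfl
  have hS' : S = G' * X 0 := by
    have h1 : NCSeries.inv G' * S = X 0 := by
      rw [hinv, sub_mul]
      conv_lhs => arg 1; rw [hrec]
      rw [mul_add, NCSeries.mul_smul', ← mul_assoc, ← mul_assoc, ← mul_assoc,
        NCSeries.inv_mul G hG0, one_mul, NCSeries.smul_mul', add_sub_cancel_right]
    rw [← h1, ← mul_assoc, NCSeries.mul_inv G' hG'0, one_mul]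
  apply ext_eta
  rw [eta_Phi_eq, eta_PhiOne, hρ, condSeries_eq_sum _ _ (poissonSeries_nil b) ψ.M_nil]
  simp only [Finset.univ_unique, Fin.default_eq_zero, sum_singleton]
  rw [← hG, ← hS, hS', mul_assoc]

theorem R_freeMeixner (b : ℝ) : (freeMeixner b 0).R = poissonSeries b := by
  let σ : Functional 1 := ofR (poissonSeries b) (poissonSeries_nil b) (adj_poissonSeries b)
  have hσ : σ.R = poissonSeries b := R_ofR _ _ _
  set τ : Functional 1 := ofJacobi (fun _ => b) fun _ => 1 with hτ
  have h1 : (freeMeixner b 0).eta = X 0 * (1 + τ.M) * X 0 := by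
    rw [freeMeixner, eta_ofJacobi, hτ]
    simp
  have h2 : τ.eta = (b : ℂ) • X 0 + X 0 * (1 + τ.M) * X 0 := by
    conv_lhs => rw [hτ, eta_ofJacobi]
    simp [hτ]
  have h3 : boolConv (freeMeixner b 0) (delta fun _ => b) = τ := by
    apply ext_eta
    rw [eta_boolConv, h1, h2, eta_delta, linSeries_const, add_comm]
  have h4 : Phi σ (freeMeixner b 0) = freeMeixner b 0 := by
    rw [Phi_eq_PhiOne_of_R hσ, h3]
    apply ext_eta
    rw [eta_PhiOne, h1]
    simp
  rw [(Phi_eq_right_iff _ _).1 h4, hσ]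

theorem isFreelyInfDiv_freeMeixner (b : ℝ) : (freeMeixner b 0).IsFreelyInfDiv := by
  rw [isFreelyInfDiv_iff, R_freeMeixner]
  exact condPos_poissonSeries b

theorem mean_freeMeixner (b : ℝ) : (freeMeixner b 0).mean = 0 := by
  funext i
  rw [mean_apply, eta_singleton, R_freeMeixner]
  simp [poissonSeries]

theorem cov_freeMeixner (b : ℝ) : (freeMeixner b 0).cov = 1 := by
  ext i j
  obtain rfl : i = j := Subsingleton.elim _ _
  rw [cov_apply, eta_pair, R_freeMeixner]
  simp [poissonSeries]

theorem Phi_freeMeixner (b : ℝ) (ψ : Functional 1) :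
    Phi (freeMeixner b 0) ψ = PhiOne (boolConv ψ (delta fun _ => b)) :=
  Phi_eq_PhiOne_of_R (R_freeMeixner b) ψ

theorem Phi_freeMeixner_zero (ψ : Functional 1) : Phi (freeMeixner 0 0) ψ = PhiOne ψ := by
  rw [Phi_freeMeixner]
  congr 1
  apply ext_eta
  rw [eta_boolConv, eta_delta, linSeries_const]
  simp

/-! ### The free product of semicircular distributions -/

theorem marginSeries_freeMeixner {d : ℕ} (i : Fin d) :
    marginSeries i (freeMeixner 0 0) = X i * X i := by
  ext u
  rw [marginSeries, R_freeMeixner]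
  rcases u with _ | ⟨j, _ | ⟨k, _ | ⟨l, u⟩⟩⟩
  · simp [poissonSeries, mul_nil, X_nil]
  · simp [poissonSeries, X_mul_cons, X_nil]
  · simp only [X_mul_cons, X]
    by_cases hj : j = i <;> by_cases hk : k = i <;> simp [poissonSeries, hj, hk]
  · simp [poissonSeries, X_mul_cons, X]

theorem Phi_freeProd_semicircular {d : ℕ} (ψ : Functional d) :
    Phi (freeProd fun _ => freeMeixner 0 0) ψ = PhiOne ψ := by
  apply ext_eta
  have hR : (freeProd fun _ : Fin d => freeMeixner 0 0).R = ∑ i, X i * X i := by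
    rw [freeProd, R_ofR]
    simp only [marginSeries_freeMeixner]
  rw [eta_Phi_eq, eta_PhiOne, hR, condSeries, comp_sum, mul_sum]
  refine sum_congr rfl fun i _ => ?_
  rw [comp_mul _ _ _ (leftDilate_nil _), comp_X _ _ (leftDilate_nil _), leftDilate, ← mul_assoc,
    ← mul_assoc, ← mul_assoc, NCSeries.inv_mul _ (one_add_nil ψ.M_nil), one_mul]

/-! ### The image of the transformation in one variable -/

/-- In one variable, a state with mean zero and variance one is in the image of the
one-argument transformation. -/
theorem exists_PhiOne_eq {φ : Functional 1} (hφ : φ.IsState) (hm : φ.mean = 0) (hc : φ.cov = 1) :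
    ∃ ψ : Functional 1, ψ.IsState ∧ PhiOne ψ = φ := by
  have h1 : φ.eta [0] = 0 := by rw [← mean_apply, hm]; rfl
  have h2 : φ.eta [0, 0] = 1 := by rw [← cov_apply, hc]; rfl
  let N : NCSeries 1 := fun u => if u = [] then 0 else φ.eta (0 :: (u ++ [0]))
  have hN : ∀ u, (1 + N) u = φ.eta (0 :: (u ++ [0])) := by
    intro u
    have e : N u = if u = [] then 0 else φ.eta (0 :: (u ++ [0])) := rfl
    rw [NCSeries.add_apply, NCSeries.one_apply, e]
    by_cases hu : u = [] <;> simp [hu, h2]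
  have hNa : NCSeries.adj N = N := by
    ext u
    have := congrFun φ.adj_eta (0 :: (u ++ [0]))
    rw [NCSeries.adj_apply] at this ⊢
    by_cases hu : u = []
    · simp [N, hu]
    · simpa [N, hu] using this
  let ψ : Functional 1 := ofM N (by simp [N]) hNa
  have hψM : ψ.M = N := M_ofM _ _ _
  refine ⟨ψ, ?_, ext_eta ?_⟩
  · rw [isState_iff, hψM]
    have := ((isState_iff_condPos_eta φ).1 hφ).submatrix fun a : List (Fin 1) => (a, (0 : Fin 1))
    convert this using 1
    ext a b
    rw [hankel_apply, hN, Matrix.submatrix_apply, condHankel_apply]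
  · rw [eta_PhiOne, hψM]
    simp only [Finset.univ_unique, Fin.default_eq_zero, sum_singleton]
    ext u
    cases u with
    | nil => rw [eta_nil, mul_nil, X_nil, mul_zero]
    | cons i u =>
      obtain rfl : i = 0 := Subsingleton.elim _ _
      rw [mul_assoc, X_mul_cons, if_pos rfl]
      rcases u.eq_nil_or_concat with rfl | ⟨v, j, rfl⟩
      · rw [mul_nil, X_nil, mul_zero, h1]
      · obtain rfl : j = 0 := Subsingleton.elim _ _
        rw [List.concat_eq_append, mul_X_concat, if_pos rfl, hN]

theorem Phi_freeMeixner_image (b : ℝ) :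
    {φ | ∃ ψ : Functional 1, ψ.IsState ∧ Phi (freeMeixner b 0) ψ = φ} =
      {φ : Functional 1 | φ.IsState ∧ φ.mean = (freeMeixner b 0).mean ∧
        φ.cov = (freeMeixner b 0).cov} := by
  ext φ
  constructor
  · rintro ⟨ψ, hψ, rfl⟩
    exact ⟨isState_Phi (isFreelyInfDiv_freeMeixner b).condPos hψ, mean_Phi _ _, cov_Phi _ _⟩
  · rintro ⟨hφ, hm, hc⟩
    rw [mean_freeMeixner] at hm
    rw [cov_freeMeixner] at hc
    obtain ⟨ψ, hψ, rfl⟩ := exists_PhiOne_eq hφ hm hc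
    refine ⟨boolConv ψ (delta fun _ => -b), ?_, ?_⟩
    · rw [isState_iff_condPos_eta] at hψ ⊢
      rwa [eta_boolConv, eta_delta, CondPos, condHankel_congr (F' := ψ.eta)]
      intro u hu
      rw [NCSeries.add_apply, linSeries_of_two_le _ _ hu, add_zero]
    · rw [Phi_freeMeixner]
      congr 1
      apply ext_eta
      rw [eta_boolConv, eta_boolConv, eta_delta, eta_delta,
        show (fun _ : Fin 1 => -b) = -fun _ => b from rfl, linSeries_neg, neg_add_cancel_right]

theorem eq_freeMeixner_of_degenerate {ρ : Functional 1} (hρ : ρ.R.CondPos) (hm : ρ.mean = 0)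
    (hc : ρ.cov = 1) (h : ρ.R [0, 0, 0, 0] = ρ.R [0, 0, 0] * ρ.R [0, 0, 0]) :
    ∃ b : ℝ, ρ = freeMeixner b 0 := by
  have h1 : ρ.R [0] = 0 := by rw [← eta_singleton, ← mean_apply, hm]; rfl
  have h2 : ρ.R [0, 0] = 1 := by rw [R_pair_of_cov hc, if_pos rfl]
  have hR3 : conj (ρ.R [0, 0, 0]) = ρ.R [0, 0, 0] := by
    simpa [NCSeries.adj_apply] using congrFun ρ.adj_R [0, 0, 0]
  have h0 : form (condHankel ρ.R)
      (Finsupp.single ([0], 0) 1 - ρ.R [0, 0, 0] • Finsupp.single ([], 0) 1)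
      (Finsupp.single ([0], 0) 1 - ρ.R [0, 0, 0] • Finsupp.single ([], 0) 1) = 0 := by
    simp only [map_sub, LinearMap.sub_apply, map_smul, LinearMap.map_smulₛₗ,
      LinearMap.smul_apply, form_single, condHankel_apply, smul_eq_mul, hR3]
    simp [h2, h]
  have hstep : ∀ n : ℕ, ρ.R (0 :: (List.replicate n 0 ++ [0, 0])) =
      ρ.R [0, 0, 0] * ρ.R (0 :: (List.replicate n 0 ++ [0])) := by
    intro n
    have := form_eq_zero_of_self hρ h0 (Finsupp.single (List.replicate n 0, 0) 1)
    simp only [map_sub, map_smul, form_single, condHankel_apply, smul_eq_mul,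
      List.reverse_replicate, List.append_nil, List.append_assoc, List.singleton_append] at this
    simp at this
    linear_combination this
  have hb : (((ρ.R [0, 0, 0]).re : ℝ) : ℂ) = ρ.R [0, 0, 0] := Complex.conj_eq_iff_re.1 hR3
  have hpow : ∀ n : ℕ, ρ.R (List.replicate (n + 2) 0) = ρ.R [0, 0, 0] ^ n := by
    intro n
    induction n with
    | zero => simpa using h2
    | succ n ih =>
      have e1 : (0 : Fin 1) :: (List.replicate n 0 ++ [0, 0]) = List.replicate (n + 1 + 2) 0 := by
        rw [show ([0, 0] : List (Fin 1)) = List.replicate 2 0 from rfl, ← List.replicate_add,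
          ← List.replicate_succ]
      have e2 : (0 : Fin 1) :: (List.replicate n 0 ++ [0]) = List.replicate (n + 2) 0 := by
        rw [show ([0] : List (Fin 1)) = List.replicate 1 0 from rfl, ← List.replicate_add,
          ← List.replicate_succ]
      rw [← e1, hstep, e2, ih, pow_succ']
  refine ⟨(ρ.R [0, 0, 0]).re, ext_R ?_⟩
  rw [R_freeMeixner]
  ext u
  have hu : u = List.replicate u.length 0 :=
    List.eq_replicate_iff.2 ⟨rfl, fun x _ => Subsingleton.elim _ _⟩
  rw [poissonSeries]
  generalize u.length = n at hu
  subst hu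
  rcases n with _ | _ | n
  · simpa using ρ.R_nil
  · simpa using h1
  · rw [hpow]
    simp [hb]

theorem Phi_image_eq_iff {ρ : Functional 1} (hρ : ρ.IsFreelyInfDiv) (hm : ρ.mean = 0)
    (hc : ρ.cov = 1) :
    {φ | ∃ ψ : Functional 1, ψ.IsState ∧ Phi ρ ψ = φ} =
        {φ : Functional 1 | φ.IsState ∧ φ.mean = ρ.mean ∧ φ.cov = ρ.cov} ↔
      ∃ b : ℝ, ρ = freeMeixner b 0 := by
  constructor
  · intro h
    have hmem : bracketState 0 ∈
        {φ : Functional 1 | φ.IsState ∧ φ.mean = ρ.mean ∧ φ.cov = ρ.cov} :=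
      ⟨isState_bracketState 0, by rw [mean_bracketState, hm], by rw [cov_bracketState, hc]⟩
    rw [← h] at hmem
    obtain ⟨ψ, hψ, he⟩ := hmem
    exact eq_freeMeixner_of_degenerate hρ.condPos hm hc
      (degenerate_of_Phi_eq_bracketState hρ.condPos hψ he 0).1
  · rintro ⟨b, rfl⟩
    exact Phi_freeMeixner_image b

end Functional

open Functional in
theorem mainTheorem4 (d : ℕ) :
    -- (a) for `φ = Φ[ρ, ψ]`, any two of `φ, ρ, ψ` determine the third
    ((∀ φ ρ ψ : Functional d, φ = Phi ρ ψ ↔ φ.eta =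
        NCSeries.inv (1 + ψ.M) * ρ.R.comp (fun i => (1 + ψ.M) * NCSeries.X i)) ∧
      (∀ ρ ρ' ψ : Functional d, Phi ρ ψ = Phi ρ' ψ → ρ = ρ') ∧
      (∀ ρ ψ ψ' : Functional d, (∀ a : Fin d → ℝ, ρ ≠ delta a) →
        Phi ρ ψ = Phi ρ ψ' → ψ = ψ')) ∧
    -- (b) positivity, mean and covariance
    ((∀ ρ ψ : Functional d, ρ.IsFreelyInfDiv → ψ.IsState → (Phi ρ ψ).IsState) ∧
      (∀ ρ ψ : Functional d, (Phi ρ ψ).mean = ρ.mean ∧ (Phi ρ ψ).cov = ρ.cov)) ∧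
    -- (c) fixed points
    ((∀ ρ ψ : Functional d, Phi ρ ψ = ψ ↔ ψ = ρ) ∧
      (∀ ρ σ : Functional d, Phi σ ρ = σ ↔ σ = ρ ∨ ∃ a : Fin d → ℝ, σ = delta a) ∧
      (∀ ψ : Functional d, PhiOne ψ = ψ ↔ ψ = freeProd fun _ => freeMeixner 0 0)) ∧
    -- (d) the image of `Φ[ρ, ·]`, in one variable and in several variables
    ((∀ ρ : Functional 1, ρ.IsFreelyInfDiv → ρ.mean = 0 → ρ.cov = 1 →
        ({φ | ∃ ψ : Functional 1, ψ.IsState ∧ Phi ρ ψ = φ} =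
            {φ : Functional 1 | φ.IsState ∧ φ.mean = ρ.mean ∧ φ.cov = ρ.cov} ↔
          ∃ b : ℝ, ρ = freeMeixner b 0)) ∧
      (∀ b : ℝ, (freeMeixner b 0).IsFreelyInfDiv ∧
        (freeMeixner b 0).mean = 0 ∧ (freeMeixner b 0).cov = 1) ∧
      (∀ ψ : Functional 1, Phi (freeMeixner 0 0) ψ = PhiOne ψ) ∧
      (∀ (b : ℝ) (ψ : Functional 1),
        Phi (freeMeixner b 0) ψ = PhiOne (boolConv ψ (delta fun _ => b))) ∧
      (2 ≤ d → ∀ ρ : Functional d, ρ.IsFreelyInfDiv → ρ.mean = 0 → ρ.cov = 1 →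
        {φ | ∃ ψ : Functional d, ψ.IsState ∧ Phi ρ ψ = φ} ≠
          {φ : Functional d | φ.IsState ∧ φ.mean = ρ.mean ∧ φ.cov = ρ.cov})) ∧
    -- (e) the image of `Φ[·, ψ]`
    ((∀ ψ : Functional d, ψ.IsState →
        ({φ | ∃ ρ : Functional d, ρ.IsFreelyInfDiv ∧ Phi ρ ψ = φ} =
            {φ : Functional d | φ.IsState} ↔
          ∃ a : Fin d → ℝ, ψ = delta a)) ∧
      Function.Bijective (BP : Functional d → Functional d) ∧
      (∀ ρ : Functional d, Phi ρ (delta 0) = Function.invFun BP ρ) ∧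
      (∀ (ρ : Functional d) (a : Fin d → ℝ),
        Phi ρ (delta a) = B a 0 (Function.invFun BP ρ)) ∧
      -- `Φ[ρ, δ_a]` is `B_{a,t}[ρ]` extended by continuity to `t = -1`
      (∀ (ρ : Functional d) (a : Fin d → ℝ) (p : NCPoly d),
        Filter.Tendsto (fun t : ℝ => B a t ρ p) (nhdsWithin (-1) {-1}ᶜ)
          (nhds (Phi ρ (delta a) p)))) := by
  refine ⟨⟨fun φ ρ ψ => ⟨?_, fun h => ext_eta (by rw [h, eta_Phi])⟩,
      fun _ _ _ => Phi_injective_left, fun _ _ _ => Phi_injective_right⟩,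
    ⟨fun _ _ hρ hψ => isState_Phi hρ.condPos hψ, fun ρ ψ => ⟨mean_Phi ρ ψ, cov_Phi ρ ψ⟩⟩,
    ⟨Phi_eq_right_iff, Phi_eq_left_iff, fun ψ => ?_⟩,
    ⟨fun _ => Phi_image_eq_iff,
      fun b => ⟨isFreelyInfDiv_freeMeixner b, mean_freeMeixner b, cov_freeMeixner b⟩,
      Phi_freeMeixner_zero, Phi_freeMeixner, fun hd _ _ => Phi_image_ne hd⟩,
    ⟨fun _ => Phi_onto_iff, BP_bijective, Phi_delta_zero, Phi_delta_eq_B, tendsto_B⟩⟩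
  · rintro rfl
    exact eta_Phi ρ ψ
  · rw [← Phi_freeProd_semicircular, Phi_eq_right_iff]
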